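/- **Setting.** Let $D$ be a distribution of pairs $(x,r)$, $x\in\mathcal X$ a context and $r\in[0,1]^K$ a reward vector over $K$ arms; $D_{\mathcal X}$ is its marginal on contexts and $f^*(x,a)=\mathbb E[r(a)\mid x]\in[0,1]$, $\pi^*(x)\in\arg\max_a f^*(x,a)$. For a probability kernel $p(\cdot|x)$ on arms, $D(p)$ is the law of $(x,a,r(a))$ with $(x,r)\sim D$, $a\sim p(\cdot|x)$. Let $\mathcal F_1,\dots,\mathcal F_M$ be classes of functions $\mathcal X\times[K]\to[0,1]$ with finite VC-subgraph dimensions $1\le d_1\le\dots\le d_M$. Put $b_i(p)=\inf_{f\in\mathcal F_i}\mathbb E_{x\sim D_{\mathcal X}}\mathbb E_{a\sim p(\cdot|x)}(f(x,a)-f^*(x,a))^2$, $B_i=\sup_p b_i(p)$, and, for a constant $C_1>0$, $\xi_j(n,\zeta)=C_1d_j\ln(n)\ln(1/\zeta)/n$. **Algorithm Mod-IGW.** Inputs $\tau_1\ge2$ and $\delta\in(0,1)$. Put $\tau_0=0$, $\tau_{m+1}=2\tau_m$ for $m\ge1$; epoch $m$ consists of the rounds $\tau_{m-1}+1,\dots,\tau_m$.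 Start with $\hat f_1=0$, $\mathcal I_1=[M]$, $\gamma_1=1$. In each round $t$ of epoch $m$ draw $(x_t,r_t)\sim D$ independently of the past, play $a_t\sim p_m(\cdot|x_t)$, observe $r_t(a_t)$, where, with $\hat a\in\arg\max_a\hat f_m(x,a)$, $p_m(a|x)=1/(K+\gamma_m(\hat f_m(x,\hat a)-\hat f_m(x,a)))$ for $a\ne\hat a$ and $p_m(\hat a|x)=1-\sum_{a\neq\hat a}p_m(a|x)$. At the end of epoch $m$, with data $S_m$ of that epoch, put $\hat f_{m+1}=\mathrm{EstOracle}_M(S_m)$, $\mathcal I_{m+1}=\{i\in\mathcal I_m:\mathrm{MTOracle}(i,S_m,\delta/(4Mm^2))=\mathrm{False}\}$, $i_{m+1}=\min\mathcal I_{m+1}$, and $\gamma_{m+1}=\sqrt{K/(8\,\xi_{i_{m+1}}(\tau_m-\tau_{m-1},\delta/(4Mm^2)))}$. The oracles may be randomized. **Assumptions.** (a) There is $C_0\ge1$ such that for all $i\in[M]$, all kernels $p$, all $n\ge2$ and all $\zeta\in(0,1/2]$, with probability at least $1-\zeta$ the output $\hat f$ of $\mathrm{EstOracle}_i$ on $n$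 i.i.d. samples of $D(p)$ satisfies $\mathbb E_{x\sim D_{\mathcal X}}\mathbb E_{a\sim p(\cdot|x)}(\hat f(x,a)-f^*(x,a))^2\le\min_{j\le i}\big(C_0b_j(p)+\xi_j(n,\zeta/i)\big)$. (b) Let $m^*_i=\max\{m\ge1:\xi_i(\tau_m-\tau_{m-1},\delta/(4Mm^2))\ge C_0\min_{i'\le i}B_{i'}\}\in\{0,1,\dots,\infty\}$ (with $\max\emptyset=0$ and $\tau_\infty=\infty$). There are $\beta'_i\in(0,1]$ and $\beta_i\in(0,\infty]$, $\beta_i$ nondecreasing in $i\in[M]$, with $\beta_i>\beta'_i\tau_{m^*_i}$ (read as $\beta_i=\infty$ if $\tau_{m_i^*}=\infty$), such that for all $i\in[M]$, all epochs $m$ and all $\zeta\in(0,1)$: $\Pr[\mathrm{MTOracle}(i,S_m,\zeta)=\mathrm{False}]\ge1-\zeta$ if $\tau_m\le\beta'_i\tau_{m^*_i}$, and $\Pr[\mathrm{MTOracle}(i,S_m,\zeta)=\mathrm{True}]\ge1-\zeta$ if $\tau_m>\beta_i$. Put $\beta_0=0$. **Theorem.** There is a constant $c$ depending only on $C_1$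 such that, under (a) and (b), with probability at least $1-\delta$, for all $i,j\in[M]$ and all integers $1\le t\le\beta'_i\tau_{m^*_i}$, $$R_t\le c\left(\tau_1+\beta_{j-1}L_{i,j}+\sqrt{\frac{d_i}{d_j}}\sqrt{K d_i\,t\,\ln(t)\,\ln\Big(\frac{M\ln t}{\delta}\Big)}\right),$$ where $L_{i,j}=\ln(d_i/d_1)$ if $j\le i$ and $L_{i,j}=1+\ln(d_i/d_1)$ if $j>i$ (with $\infty\cdot0=0$; the last term is read as $0$ if $t=1$ or if the last logarithm is negative, which can happen only for $t\le2$). Here $R_t=\sum_{s=1}^t[f^*(x_s,\pi^*(x_s))-f^*(x_s,a_s)]$; on the same event, the bound also holds with each summand replaced by its conditional expectation given the rounds before $s$. -/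

import Mathlib

open MeasureTheory ProbabilityTheory

namespace ContextualBandit

noncomputable section

/-! ### Contextual bandit environment -/

/-- A stochastic contextual bandit with contexts in `X` and arms `Fin K`: a distribution `D` of
pairs (context, reward vector) with rewards in `[0,1]`, together with (a version of) the
conditional mean reward `fstar x a = E[r(a) | x]`, which takes values in `[0,1]`. -/
structure Env (X : Type*) [MeasurableSpace X] (K : ℕ) where
  D : Measure (X × (Fin K → ℝ))
  isProb : IsProbabilityMeasure D
  reward_mem : ∀ᵐ e ∂D, ∀ a, e.2 a ∈ Set.Icc (0 : ℝ) 1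
  fstar : X → Fin K → ℝ
  fstar_measurable : ∀ a, Measurable fun x => fstar x a
  fstar_mem : ∀ x a, fstar x a ∈ Set.Icc (0 : ℝ) 1
  fstar_condExp : ∀ a,
    D[fun e => e.2 a | MeasurableSpace.comap Prod.fst inferInstance] =ᵐ[D] fun e => fstar e.1 a

/-- A model: a measurable map from contexts and arms to `[0,1]`. -/
def IsModel {X : Type*} [MeasurableSpace X] {K : ℕ} (f : X → Fin K → ℝ) : Prop :=
  (∀ a, Measurable fun x => f x a) ∧ ∀ x a, f x a ∈ Set.Icc (0 : ℝ) 1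

/-- A probability kernel (randomized arm selection rule); `p x a` is the probability `p(a|x)`. -/
def IsActionKernel {X : Type*} [MeasurableSpace X] {K : ℕ} (p : X → Fin K → ℝ) : Prop :=
  (∀ a, Measurable fun x => p x a) ∧ (∀ x a, 0 ≤ p x a) ∧ ∀ x, ∑ a, p x a = 1

/-- The distribution `D(p)` of `(x, a, r(a))` for `(x, r) ∼ D` and `a ∼ p(·|x)`. -/
def sampleLaw {X : Type*} [MeasurableSpace X] {K : ℕ} (E : Env X K) (p : X → Fin K → ℝ) :
    Measure (X × Fin K × ℝ) :=
  ∑ a : Fin K, (E.D.withDensity fun e => ENNReal.ofReal (p e.1 a)).map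
    fun e => (e.1, a, e.2 a)

/-- `E_{x ∼ D_X} E_{a ∼ p(·|x)} (f(x,a) - f*(x,a))²`. -/
def sqError {X : Type*} [MeasurableSpace X] {K : ℕ} (E : Env X K) (p f : X → Fin K → ℝ) : ℝ :=
  ∫ x, ∑ a : Fin K, p x a * (f x a - E.fstar x a) ^ 2 ∂E.D.fst

/-- Average squared misspecification error `b(p)` of the class `F` under `D(p)`. -/
def misspec {X : Type*} [MeasurableSpace X] {K : ℕ} (E : Env X K) (F : Set (X → Fin K → ℝ))
    (p : X → Fin K → ℝ) : ℝ :=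
  sInf (sqError E p '' F)

/-- Average squared misspecification error `B` of the class `F` (worst case over kernels). -/
def worstMisspec {X : Type*} [MeasurableSpace X] {K : ℕ} (E : Env X K)
    (F : Set (X → Fin K → ℝ)) : ℝ :=
  sSup (misspec E F '' {p | IsActionKernel p})

/-- The finite set `T` of points `((x, a), s)` is shattered by the subgraphs
`{((x, a), s) | s < f x a}` of the functions `f ∈ F`. -/
def SubgraphShatters {X : Type*} {K : ℕ} (F : Set (X → Fin K → ℝ))
    (T : Finset ((X × Fin K) × ℝ)) : Prop :=
  ∀ U ⊆ T, ∃ f ∈ F, ∀ q ∈ T, (q ∈ U ↔ q.2 < f q.1.1 q.1.2)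

/-- VC-subgraph dimension of a class of functions. -/
def vcSubgraphDim {X : Type*} {K : ℕ} (F : Set (X → Fin K → ℝ)) : ℕ∞ :=
  ⨆ (T : Finset ((X × Fin K) × ℝ)) (_ : SubgraphShatters F T), (T.card : ℕ∞)

/-! ### Inputs of the algorithm -/

/-- The inputs of Mod-IGW. Classes are numbered `1, …, M`. An oracle receives a data set of `n`
samples `(x, a, r(a))` and may use internal randomness, which is a seed in `S` with law `seedLaw`.
* `est i n data seed` is the model returned by the `i`-th estimation oracle;
* `mt i n data ζ seed` is the answer of the misspecification test for class `i` at confidence `ζ`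
  (`true`: class `i` is declared misspecified);
* `greedy` is an arbitrary (measurable) rule choosing a maximal coordinate of a vector. -/
structure Inputs (X S : Type*) [MeasurableSpace X] [MeasurableSpace S] (K : ℕ) where
  M : ℕ
  d : ℕ → ℕ
  C₁ : ℝ
  τ₁ : ℕ
  δ : ℝ
  two_le_τ₁ : 2 ≤ τ₁
  δ_pos : 0 < δ
  δ_lt_one : δ < 1
  seedLaw : Measure S
  isProb : IsProbabilityMeasure seedLaw
  est : ℕ → (n : ℕ) → (Fin n → X × Fin K × ℝ) → S → X → Fin K → ℝ
  est_measurable : ∀ i n a, Measurable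
    fun q : ((Fin n → X × Fin K × ℝ) × S) × X => est i n q.1.1 q.1.2 q.2 a
  est_mem : ∀ i n data s x a, est i n data s x a ∈ Set.Icc (0 : ℝ) 1
  mt : ℕ → (n : ℕ) → (Fin n → X × Fin K × ℝ) → ℝ → S → Bool
  mt_measurable : ∀ i n ζ, Measurable
    fun q : (Fin n → X × Fin K × ℝ) × S => mt i n q.1 ζ q.2
  greedy : (Fin K → ℝ) → Fin K
  greedy_measurable : Measurable greedy
  greedy_max : ∀ (v : Fin K → ℝ) (a : Fin K), v a ≤ v (greedy v)

/-- Everything that happens in one round: context, reward vector, chosen arm and a seed.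
Only the seeds of the last rounds of the epochs are used (by the oracles called there). -/
abbrev Round (X S : Type*) (K : ℕ) : Type _ := X × (Fin K → ℝ) × Fin K × S

namespace Inputs

variable {X S : Type*} [MeasurableSpace X] [MeasurableSpace S] {K : ℕ} (A : Inputs X S K)

/-- Last round `τ_m` of epoch `m`: `τ_0 = 0`, `τ_1` is given, and `τ_{m+1} = 2 τ_m` for `m ≥ 1`. -/
def τ : ℕ → ℕ
  | 0 => 0
  | m + 1 => 2 ^ m * A.τ₁

/-- Number of rounds in epoch `m`. -/
def len (m : ℕ) : ℕ := A.τ m - A.τ (m - 1)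

/-- The epoch containing round `t ≥ 1`. -/
def epoch (t : ℕ) : ℕ := sInf {m | t ≤ A.τ m}

/-- Estimation rate `ξ_i(n, ζ) = C₁ d_i ln(n) ln(1/ζ) / n`. -/
def ξ (i n : ℕ) (ζ : ℝ) : ℝ := A.C₁ * A.d i * Real.log n * Real.log (1 / ζ) / n

/-- Confidence level `δ / (4 M m²)` used at the end of epoch `m`. -/
def conf (m : ℕ) : ℝ := A.δ / (4 * A.M * m ^ 2)

/-- Exploration parameter `γ_{m+1,i}` (the first argument is `m ≥ 1`). -/
def γSucc (m i : ℕ) : ℝ := √(K / (8 * A.ξ i (A.len m) (A.conf m)))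

/-- Data `S_m` of epoch `m` in the history `h` (rounds are numbered from `1`). -/
def data (h : ℕ → Round X S K) (m : ℕ) : Fin (A.len m) → X × Fin K × ℝ := fun k =>
  let z := h (A.τ (m - 1) + k + 1)
  (z.1, z.2.2.1, z.2.1 z.2.2.1)

/-- Seed for the oracle calls at the end of epoch `m`. -/
def seed (h : ℕ → Round X S K) (m : ℕ) : S := (h (A.τ m)).2.2.2

/-- Result of the misspecification test for class `i` on the data of epoch `m`. -/
def test (h : ℕ → Round X S K) (i m : ℕ) (ζ : ℝ) : Bool :=
  A.mt i (A.len m) (A.data h m) ζ (A.seed h m)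

/-- Reward model `f̂_m`: `f̂_1 = 0` and `f̂_{m+1} = EstOracle_M(S_m)` (index `0` is unused). -/
def fhat (h : ℕ → Round X S K) : ℕ → X → Fin K → ℝ
  | 0 => fun _ _ => 0
  | 1 => fun _ _ => 0
  | m + 2 => A.est A.M (A.len (m + 1)) (A.data h (m + 1)) (A.seed h (m + 1))

/-- Set `I_m` of possibly well-specified class indices (index `0` is unused). -/
def indexSet (h : ℕ → Round X S K) : ℕ → Finset ℕ
  | 0 => Finset.Icc 1 A.M
  | 1 => Finset.Icc 1 A.M
  | m + 2 => (indexSet h (m + 1)).filter fun i => A.test h i (m + 1) (A.conf (m + 1)) = false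

/-- Smallest element `i_m` of `I_m` (by convention `M` if all classes have been rejected). -/
def index (h : ℕ → Round X S K) (m : ℕ) : ℕ :=
  if hI : (A.indexSet h m).Nonempty then (A.indexSet h m).min' hI else A.M

/-- Exploration parameter `γ_m` used by the algorithm: `γ_1 = 1`, `γ_{m+1} = γ_{m+1, i_{m+1}}`. -/
def γ (h : ℕ → Round X S K) : ℕ → ℝ
  | 0 => 1
  | 1 => 1
  | m + 2 => A.γSucc (m + 1) (A.index h (m + 2))

/-- Inverse gap weighting for the model `f` with exploration parameter `g`. -/
def igw (f : X → Fin K → ℝ) (g : ℝ) (x : X) (a : Fin K) : ℝ :=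
  if a = A.greedy (f x) then
    1 - ∑ a' ∈ Finset.univ.erase a, 1 / (K + g * (f x a - f x a'))
  else 1 / (K + g * (f x (A.greedy (f x)) - f x a))

/-- Action selection kernel `p_m` of epoch `m`; it depends on the history `h` only through the
rounds of the earlier epochs. -/
def kernel (h : ℕ → Round X S K) (m : ℕ) : X → Fin K → ℝ := A.igw (A.fhat h m) (A.γ h m)

/-- Law of one round in which arms are drawn from `p`: `(x, r) ∼ D`, `a ∼ p(·|x)`, and an
independent seed. -/
def stepLaw (E : Env X K) (p : X → Fin K → ℝ) : Measure (Round X S K) :=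
  ∑ a : Fin K, ((E.D.withDensity fun e => ENNReal.ofReal (p e.1 a)).prod A.seedLaw).map
    fun q => (q.1.1, q.1.2, a, q.2)

/-- `z 1, z 2, …` are the rounds of a run of Mod-IGW in the environment `E`: the process is adapted
to `ℱ`, and the conditional law of round `t + 1` given `ℱ t` is the one-round law with the action
selection kernel of the epoch of round `t + 1`, computed from the run so far. -/
structure IsRun {Ω : Type*} [mΩ : MeasurableSpace Ω] (E : Env X K) (P : Measure Ω)
    (ℱ : Filtration ℕ mΩ) (z : ℕ → Ω → Round X S K) : Prop where
  adapted : ∀ t, 1 ≤ t → Measurable[ℱ t] (z t)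
  law : ∀ t, ∀ G : Set Ω, MeasurableSet[ℱ t] G → ∀ B : Set (Round X S K), MeasurableSet B →
    P (G ∩ z (t + 1) ⁻¹' B) =
      ∫⁻ ω in G, A.stepLaw E (A.kernel (fun s => z s ω) (A.epoch (t + 1))) B ∂P

/-! ### Regret -/

/-- Regret `f*(x, π*(x)) - f*(x, a)`, where `f*(x, π*(x))` is the maximum of `f*(x, ·)`. -/
def _root_.ContextualBandit.Env.regret (E : Env X K) (x : X) (a : Fin K) : ℝ :=
  (⨆ a', E.fstar x a') - E.fstar x a

/-- Cumulative regret `R_t` up to round `t` in the history `h`. -/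
def cumRegret (E : Env X K) (h : ℕ → Round X S K) (t : ℕ) : ℝ :=
  ∑ s ∈ Finset.Icc 1 t, E.regret (h s).1 (h s).2.2.1

/-- Conditional version of the cumulative regret: the regret of each round `s ≤ t` is replaced by
its conditional expectation `E_{x ∼ D_X} ∑_a p_{m(s)}(a|x) (f*(x, π*(x)) - f*(x, a))` given the
preceding rounds. -/
def cumCondRegret (E : Env X K) (h : ℕ → Round X S K) (t : ℕ) : ℝ :=
  ∑ s ∈ Finset.Icc 1 t, ∫ x, ∑ a, A.kernel h (A.epoch s) x a * E.regret x a ∂E.D.fst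

/-! ### Assumptions -/

/-- The estimation oracles have the rates `ξ_j`, with constant `C₀`, on the classes `F 1, …, F M`:
on `n` i.i.d. samples from `D(p)`, the `i`-th oracle has, with probability at least `1 - ζ`, error
at most `min_{j ≤ i} (C₀ b_j(p) + ξ_j(n, ζ / i))`.
Sample size one and levels `ζ > 1/2` are not required (so this assumes less than asking for all
`n` and all `ζ < 1`): there the rate can vanish, `ξ_j(1, ζ) = 0` and `ξ_1(n, ζ) → 0` as `ζ → 1`. -/
def EstOracleAssumption (E : Env X K) (F : ℕ → Set (X → Fin K → ℝ)) (C₀ : ℝ) : Prop :=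
  ∀ i ∈ Finset.Icc 1 A.M, ∀ p, IsActionKernel p → ∀ n : ℕ, 2 ≤ n →
    ∀ ζ : ℝ, 0 < ζ → ζ ≤ 1 / 2 →
      ENNReal.ofReal (1 - ζ) ≤
        ((Measure.pi fun _ : Fin n => sampleLaw E p).prod A.seedLaw)
          {q | ∀ j ∈ Finset.Icc 1 i,
            sqError E p (A.est i n q.1 q.2) ≤ C₀ * misspec E (F j) p + A.ξ j n (ζ / i)}

/-- Safe epoch `m*_i`, the last epoch `m ≥ 1` with
`ξ_i(τ_m - τ_{m-1}, δ/(4 M m²)) ≥ C₀ min_{i' ≤ i} B_{i'}`. It is `⊤` if there are infinitely many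
such epochs, and `0` if there is none. -/
def safeEpoch (E : Env X K) (F : ℕ → Set (X → Fin K → ℝ)) (C₀ : ℝ) (i : ℕ) : ℕ∞ :=
  sSup ((fun m : ℕ => (m : ℕ∞)) '' {m : ℕ | 1 ≤ m ∧
    C₀ * sInf ((fun i' => worstMisspec E (F i')) '' Set.Icc 1 i) ≤ A.ξ i (A.len m) (A.conf m)})

open Classical in
/-- `τ_{m*_i}`, with `τ_∞ = ∞`. -/
def safeTime (E : Env X K) (F : ℕ → Set (X → Fin K → ℝ)) (C₀ : ℝ) (i : ℕ) : ENNReal :=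
  if A.safeEpoch E F C₀ i = ⊤ then ⊤ else (A.τ (A.safeEpoch E F C₀ i).toNat : ENNReal)

/-- The misspecification test assumption for a run `z` with parameters `β_i ∈ [0, ∞]` and
`β'_i ∈ (0, 1]`. The condition `β_i > β'_i τ_{m*_i}` is read as `β_i = ∞` when `τ_{m*_i} = ∞`. -/
structure TestAssumption {Ω : Type*} [MeasurableSpace Ω] (E : Env X K)
    (F : ℕ → Set (X → Fin K → ℝ)) (C₀ : ℝ) (P : Measure Ω) (z : ℕ → Ω → Round X S K)
    (β : ℕ → ENNReal) (β' : ℕ → ℝ) : Prop where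
  β_zero : β 0 = 0
  β_mono : ∀ i ∈ Finset.Icc 1 A.M, ∀ j ∈ Finset.Icc 1 A.M, i ≤ j → β i ≤ β j
  β'_mem : ∀ i ∈ Finset.Icc 1 A.M, β' i ∈ Set.Ioc (0 : ℝ) 1
  β'_lt : ∀ i ∈ Finset.Icc 1 A.M,
    ENNReal.ofReal (β' i) * A.safeTime E F C₀ i < β i ∨ β i = ⊤
  accept : ∀ i ∈ Finset.Icc 1 A.M, ∀ m : ℕ, 1 ≤ m → ∀ ζ ∈ Set.Ioo (0 : ℝ) 1,
    (A.τ m : ENNReal) ≤ ENNReal.ofReal (β' i) * A.safeTime E F C₀ i →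
      ENNReal.ofReal (1 - ζ) ≤ P {ω | A.test (fun s => z s ω) i m ζ = false}
  reject : ∀ i ∈ Finset.Icc 1 A.M, ∀ m : ℕ, 1 ≤ m → ∀ ζ ∈ Set.Ioo (0 : ℝ) 1,
    β i < (A.τ m : ENNReal) →
      ENNReal.ofReal (1 - ζ) ≤ P {ω | A.test (fun s => z s ω) i m ζ = true}

/-- The logarithmic factor of `β_{j-1}`: it is `ln(d_i/d_1)` in the main case `j ≤ i`, and
`1 + ln(d_i/d_1)` for `j > i`. -/
def logFactor (i j : ℕ) : ℝ :=
  if j ≤ i then Real.log (A.d i / A.d 1) else 1 + Real.log (A.d i / A.d 1)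

/-- The quantity
`τ_1 + β_{j-1} ln(d_i/d_1) + √(d_i/d_j) √(K d_i t ln(t) ln(M ln(t)/δ))` (for `j ≤ i`). -/
def regretBound (β : ℕ → ENNReal) (i j t : ℕ) : ENNReal :=
  (A.τ₁ : ENNReal) + β (j - 1) * ENNReal.ofReal (A.logFactor i j) +
    ENNReal.ofReal (√((A.d i : ℝ) / A.d j) *
      √(K * A.d i * t * Real.log t * Real.log (A.M * Real.log t / A.δ)))

end Inputs

end

end ContextualBandit

open ContextualBandit

namespace ContextualBandit

/-! Inverse gap weighting plays an arm with probability at least `1 / (K + γ * gap)`. Hence the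
squared error of the next model on the collected data controls its deviation from `fstar` under
every kernel `q`, at a price governed by the estimated gap of `q` (`meanDev_le`). If estimated and
true gaps agree up to a factor two and an additive error `c`, the same therefore holds for the next
model with error `c / 4` plus a term of order `K / γ + e * γ`, where `e` is the squared error
(`GapsComparable.step`). Gaps lie in `[0, 1]`, so `c = 1` is available for free at any epoch `k`.
However badly `γ` was chosen before, this initial error then decays by a factor 4 per epoch while
the epochs only double, so the burn-in costs `O(τ (k + 1))` in total.

The stationary term depends on the selected index. Class `i` passes all tests up to its safe time,
so the index is at most `i` and `K / γ` is at most of order `√(K * rate i)`. Classes below `j` are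
rejected after `β (j - 1)`, so the index is at least `j` from then on; rates within an epoch are
proportional to the dimensions, so `γ` overshoots the tuning for `i` by at most `√(d i / d j)`.
Moreover `e ≤ 6 * rate i`: the oracle adapts to the best class, and before the safe time the
misspecification is dominated by the rate of a later epoch, hence by the present one up to a factor
5 (`GoodHistory.sqError_le`).

The random part is a union bound (`IsRun.exists_good`). Given the past, the data of an epoch are
i.i.d. (`IsRun.measure_data_seed_mem`), so the oracle guarantee applies to the random kernel; the
regret is compared with its conditional version by Azuma–Hoeffding.

On the good event, `k` is the first epoch that ends after `β (j - 1)`. The logarithmic factor needs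
no summation over classes: if `d i ≥ 2 * d 1` it is bounded below, and otherwise comparing with
class 1 from the first epoch loses only a constant. If `j > i`, already `t ≤ β (j - 1)`. -/

instance {X : Type*} [MeasurableSpace X] {K : ℕ} (E : Env X K) : IsProbabilityMeasure E.D :=
  E.isProb

instance {X S : Type*} [MeasurableSpace X] [MeasurableSpace S] {K : ℕ} (A : Inputs X S K) :
    IsProbabilityMeasure A.seedLaw :=
  A.isProb

/-! ### Models and action kernels -/

section Basic

variable {X : Type*} [MeasurableSpace X] {K : ℕ}

lemma Env.isModel_fstar (E : Env X K) : IsModel E.fstar :=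
  ⟨E.fstar_measurable, E.fstar_mem⟩

lemma IsModel.measurable_vec {f : X → Fin K → ℝ} (hf : IsModel f) : Measurable f :=
  measurable_pi_lambda _ hf.1

lemma IsActionKernel.le_one {q : X → Fin K → ℝ} (hq : IsActionKernel q) (x : X) (a : Fin K) :
    q x a ≤ 1 := by
  rw [← hq.2.2 x]
  exact Finset.single_le_sum (fun b _ => hq.2.1 x b) (Finset.mem_univ a)

lemma IsActionKernel.sum_mul_le {q : X → Fin K → ℝ} (hq : IsActionKernel q) (x : X)
    {v : Fin K → ℝ} {c : ℝ} (hv : ∀ a, v a ≤ c) : ∑ a, q x a * v a ≤ c := by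
  calc ∑ a, q x a * v a ≤ ∑ a, q x a * c :=
        Finset.sum_le_sum fun a _ => mul_le_mul_of_nonneg_left (hv a) (hq.2.1 x a)
    _ = c := by rw [← Finset.sum_mul, hq.2.2 x, one_mul]

lemma IsActionKernel.sum_mul_nonneg {q : X → Fin K → ℝ} (hq : IsActionKernel q) (x : X)
    {v : Fin K → ℝ} (hv : ∀ a, 0 ≤ v a) : 0 ≤ ∑ a, q x a * v a :=
  Finset.sum_nonneg fun a _ => mul_nonneg (hq.2.1 x a) (hv a)

lemma IsActionKernel.integrable_sum_mul {q v : X → Fin K → ℝ} (hq : IsActionKernel q)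
    (μ : Measure X) [IsFiniteMeasure μ] (hv : ∀ a, Measurable fun x => v x a)
    (h0 : ∀ x a, 0 ≤ v x a) (h1 : ∀ x a, v x a ≤ 1) :
    Integrable (fun x => ∑ a, q x a * v x a) μ := by
  have hm : Measurable fun x => ∑ a, q x a * v x a :=
    Finset.measurable_fun_sum _ fun a _ => (hq.1 a).mul (hv a)
  refine Integrable.of_bound hm.aestronglyMeasurable 1 (Filter.Eventually.of_forall fun x => ?_)
  rw [Real.norm_of_nonneg (hq.sum_mul_nonneg x (h0 x))]
  exact hq.sum_mul_le x (h1 x)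

lemma abs_sub_le_one_of_mem {u v : ℝ} (hu : u ∈ Set.Icc (0 : ℝ) 1) (hv : v ∈ Set.Icc (0 : ℝ) 1) :
    |u - v| ≤ 1 :=
  abs_sub_le_iff.2 ⟨by linarith [hu.2, hv.1], by linarith [hv.2, hu.1]⟩

lemma integrable_sqError (E : Env X K) {p f : X → Fin K → ℝ} (hp : IsActionKernel p)
    (hf : IsModel f) :
    Integrable (fun x => ∑ a, p x a * (f x a - E.fstar x a) ^ 2) E.D.fst := by
  refine hp.integrable_sum_mul _ (fun a => ((hf.1 a).sub (E.fstar_measurable a)).pow_const 2)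
    (fun x a => sq_nonneg _) fun x a => ?_
  rw [sq_le_one_iff_abs_le_one]
  exact abs_sub_le_one_of_mem (hf.2 x a) (E.fstar_mem x a)

lemma sqError_nonneg (E : Env X K) {p : X → Fin K → ℝ} (hp : IsActionKernel p)
    (f : X → Fin K → ℝ) : 0 ≤ sqError E p f :=
  integral_nonneg fun x => hp.sum_mul_nonneg x fun _ => sq_nonneg _

lemma integral_le_one_of_le_one {μ : Measure X} [IsProbabilityMeasure μ] {v : X → ℝ}
    (h0 : ∀ x, 0 ≤ v x) (h1 : ∀ x, v x ≤ 1) : ∫ x, v x ∂μ ≤ 1 := by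
  have h := norm_integral_le_of_norm_le_const (μ := μ) (f := v) (C := 1)
    (Filter.Eventually.of_forall fun x => by rw [Real.norm_of_nonneg (h0 x)]; exact h1 x)
  simp only [probReal_univ, mul_one] at h
  exact (le_abs_self _).trans h

lemma sqError_le_one (E : Env X K) {p f : X → Fin K → ℝ} (hp : IsActionKernel p)
    (hf : IsModel f) : sqError E p f ≤ 1 := by
  refine integral_le_one_of_le_one (fun x => hp.sum_mul_nonneg x fun _ => sq_nonneg _) fun x => ?_
  refine hp.sum_mul_le x fun a => ?_
  rw [sq_le_one_iff_abs_le_one]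
  exact abs_sub_le_one_of_mem (hf.2 x a) (E.fstar_mem x a)

lemma misspec_le_worstMisspec (E : Env X K) {F : Set (X → Fin K → ℝ)} (hF : ∀ f ∈ F, IsModel f)
    {p : X → Fin K → ℝ} (hp : IsActionKernel p) : misspec E F p ≤ worstMisspec E F := by
  refine le_csSup ⟨1, ?_⟩ (Set.mem_image_of_mem _ hp)
  rintro _ ⟨q, hq, rfl⟩
  -- For the empty class the misspecification is `sInf ∅ = 0`, which respects the same bound.
  rcases F.eq_empty_or_nonempty with rfl | ⟨f, hf⟩
  · simp [misspec]
  · refine (csInf_le ⟨0, ?_⟩ (Set.mem_image_of_mem _ hf)).trans (sqError_le_one E hq (hF f hf))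
    rintro _ ⟨g, -, rfl⟩
    exact sqError_nonneg E hq g

end Basic

namespace Inputs

lemma K_pos {X S : Type*} [MeasurableSpace X] [MeasurableSpace S] {K : ℕ} (A : Inputs X S K) :
    0 < K :=
  (A.greedy 0).pos

variable {X S : Type*} [MeasurableSpace X] [MeasurableSpace S] {K : ℕ} (A : Inputs X S K)

/-! ### Gaps with respect to a model -/

/-- Loss of value of arm `a` in context `x` against the greedy arm of the model `f`. -/
noncomputable def gap (f : X → Fin K → ℝ) (x : X) (a : Fin K) : ℝ := f x (A.greedy (f x)) - f x a

lemma gap_nonneg (f : X → Fin K → ℝ) (x : X) (a : Fin K) : 0 ≤ A.gap f x a :=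
  sub_nonneg.2 (A.greedy_max _ _)

lemma gap_le_one {f : X → Fin K → ℝ} (hf : IsModel f) (x : X) (a : Fin K) : A.gap f x a ≤ 1 :=
  (le_abs_self _).trans (abs_sub_le_one_of_mem (hf.2 x _) (hf.2 x a))

lemma measurable_eval {Y : Type*} [MeasurableSpace Y] {n : ℕ} {v : Y → Fin n → ℝ}
    {a : Y → Fin n} (hv : Measurable v) (ha : Measurable a) : Measurable fun y => v y (a y) :=
  (measurable_from_prod_countable_left (f := fun q : (Fin n → ℝ) × Fin n => q.1 q.2)
    fun a => measurable_pi_apply a).comp (hv.prodMk ha)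

lemma measurable_greedy_eval {Y : Type*} [MeasurableSpace Y] {v : Y → Fin K → ℝ}
    (hv : Measurable v) : Measurable fun y => v y (A.greedy (v y)) :=
  measurable_eval hv (A.greedy_measurable.comp hv)

lemma measurable_gap {f : X → Fin K → ℝ} (hf : IsModel f) (a : Fin K) :
    Measurable fun x => A.gap f x a :=
  (A.measurable_greedy_eval hf.measurable_vec).sub (hf.1 a)

/-- The greedy arm attains the supremum. Regret thereby becomes a gap, and true and estimated gaps
are treated alike. -/
lemma regret_eq_gap (E : Env X K) (x : X) (a : Fin K) : E.regret x a = A.gap E.fstar x a := by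
  have : Nonempty (Fin K) := ⟨A.greedy 0⟩
  unfold Env.regret gap
  congr 1
  exact le_antisymm (ciSup_le fun a' => A.greedy_max _ _)
    (le_ciSup (f := fun a' => E.fstar x a') (Set.finite_range _).bddAbove _)

/-- Expected gap of the arms drawn from the kernel `q`. -/
noncomputable def expGap (E : Env X K) (f q : X → Fin K → ℝ) : ℝ := ∫ x, ∑ a, q x a * A.gap f x a ∂E.D.fst

lemma integrable_gap (E : Env X K) {f q : X → Fin K → ℝ} (hf : IsModel f)
    (hq : IsActionKernel q) : Integrable (fun x => ∑ a, q x a * A.gap f x a) E.D.fst :=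
  hq.integrable_sum_mul _ (A.measurable_gap hf) (A.gap_nonneg f) (A.gap_le_one hf)

lemma expGap_nonneg (E : Env X K) {q : X → Fin K → ℝ} (f : X → Fin K → ℝ)
    (hq : IsActionKernel q) : 0 ≤ A.expGap E f q :=
  integral_nonneg fun x => hq.sum_mul_nonneg x (A.gap_nonneg f x)

lemma expGap_le_one (E : Env X K) {f q : X → Fin K → ℝ} (hf : IsModel f)
    (hq : IsActionKernel q) : A.expGap E f q ≤ 1 :=
  integral_le_one_of_le_one (fun x => hq.sum_mul_nonneg x (A.gap_nonneg f x))
    fun x => hq.sum_mul_le x (A.gap_le_one hf x)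

/-- The kernel that plays the greedy arm of `f`. -/
noncomputable def greedyKernel (f : X → Fin K → ℝ) (x : X) (a : Fin K) : ℝ :=
  if a = A.greedy (f x) then 1 else 0

lemma isActionKernel_greedyKernel {f : X → Fin K → ℝ} (hf : IsModel f) :
    IsActionKernel (A.greedyKernel f) := by
  refine ⟨fun a => ?_, fun x a => ?_, fun x => ?_⟩
  · exact Measurable.ite (measurableSet_eq_fun measurable_const
      (A.greedy_measurable.comp hf.measurable_vec)) measurable_const measurable_const
  · unfold greedyKernel; split_ifs <;> norm_num
  · simp [greedyKernel]

lemma expGap_greedyKernel (E : Env X K) (f : X → Fin K → ℝ) :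
    A.expGap E f (A.greedyKernel f) = 0 := by
  simp [expGap, greedyKernel, gap]

/-! ### Inverse gap weighting -/

lemma one_div_add_le {g D : ℝ} (hK : 0 < K) (hg : 0 ≤ g) (hD : 0 ≤ D) :
    1 / ((K : ℝ) + g * D) ≤ 1 / K := by
  have hK' : (0 : ℝ) < K := by exact_mod_cast hK
  exact one_div_le_one_div_of_le hK' (by nlinarith [mul_nonneg hg hD])

lemma one_div_le_igw (f : X → Fin K → ℝ) {g : ℝ} (hg : 0 ≤ g) (x : X) (a : Fin K) :
    1 / ((K : ℝ) + g * A.gap f x a) ≤ A.igw f g x a := by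
  have hK := A.K_pos
  have hK' : (0 : ℝ) < K := by exact_mod_cast hK
  unfold igw
  split_ifs with h
  -- Each of the `K - 1` other arms receives at most `1 / K`, so at least `1 / K` is left for the
  -- greedy arm.
  · have h1 : ∑ a' ∈ Finset.univ.erase a, 1 / ((K : ℝ) + g * (f x a - f x a')) ≤
        ∑ a' ∈ Finset.univ.erase a, 1 / (K : ℝ) := Finset.sum_le_sum fun a' _ => by
      have := A.gap_nonneg f x a'
      rw [gap, ← h] at this
      exact one_div_add_le hK hg this
    rw [Finset.sum_const, Finset.card_erase_of_mem (Finset.mem_univ _), Finset.card_univ,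
      Fintype.card_fin, nsmul_eq_mul, Nat.cast_sub hK] at h1
    have h2 := one_div_add_le hK hg (A.gap_nonneg f x a)
    have h3 : ((K : ℝ) - (1 : ℕ)) * (1 / K) = 1 - 1 / K := by
      push_cast; field_simp
    linarith
  · exact le_refl _

lemma igw_nonneg (f : X → Fin K → ℝ) {g : ℝ} (hg : 0 ≤ g) (x : X) (a : Fin K) :
    0 ≤ A.igw f g x a := by
  refine le_trans ?_ (A.one_div_le_igw f hg x a)
  have := mul_nonneg hg (A.gap_nonneg f x a)
  positivity

lemma igw_sum (f : X → Fin K → ℝ) (g : ℝ) (x : X) : ∑ a, A.igw f g x a = 1 := by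
  rw [← Finset.add_sum_erase _ _ (Finset.mem_univ (A.greedy (f x)))]
  have h : ∀ a ∈ Finset.univ.erase (A.greedy (f x)),
      A.igw f g x a = 1 / (K + g * (f x (A.greedy (f x)) - f x a)) := fun a ha => by
    rw [igw, if_neg (Finset.ne_of_mem_erase ha)]
  rw [Finset.sum_congr rfl h, igw, if_pos rfl]
  ring

/-- An arm with gap `D` contributes at most `D / (K + g * D) ≤ 1 / g`, and the greedy arm
contributes nothing. -/
lemma sum_igw_mul_gap_le (f : X → Fin K → ℝ) {g : ℝ} (hg : 0 < g) (x : X) :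
    ∑ a, A.igw f g x a * A.gap f x a ≤ K / g := by
  have hK' : (0 : ℝ) < K := by exact_mod_cast A.K_pos
  have h : ∀ a ∈ Finset.univ, A.igw f g x a * A.gap f x a ≤ 1 / g := fun a _ => by
    have hD := A.gap_nonneg f x a
    by_cases ha : a = A.greedy (f x)
    · have : A.gap f x a = 0 := by simp [gap, ha]
      rw [this, mul_zero]; positivity
    · rw [igw, if_neg ha]
      change 1 / ((K : ℝ) + g * A.gap f x a) * A.gap f x a ≤ 1 / g
      rw [div_mul_eq_mul_div, one_mul, div_le_div_iff₀ (by positivity) hg]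
      nlinarith
  refine (Finset.sum_le_sum h).trans (le_of_eq ?_)
  simp [div_eq_mul_inv]

lemma measurable_igw_comp {Y : Type*} [MeasurableSpace Y] {f : Y → X → Fin K → ℝ} {g : Y → ℝ}
    {x : Y → X} (hf : Measurable fun y => f y (x y)) (hg : Measurable g) (a : Fin K) :
    Measurable fun y => A.igw (f y) (g y) (x y) a := by
  have hfa : ∀ b, Measurable fun y => f y (x y) b := fun b => (measurable_pi_apply b).comp hf
  unfold igw
  refine Measurable.ite (measurableSet_eq_fun measurable_const (A.greedy_measurable.comp hf)) ?_ ?_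
  · exact measurable_const.sub (Finset.measurable_fun_sum _ fun b _ =>
      measurable_const.div (measurable_const.add (hg.mul ((hfa a).sub (hfa b)))))
  · exact measurable_const.div (measurable_const.add
      (hg.mul ((A.measurable_greedy_eval hf).sub (hfa a))))

lemma isActionKernel_igw {f : X → Fin K → ℝ} (hf : IsModel f) {g : ℝ} (hg : 0 ≤ g) :
    IsActionKernel (A.igw f g) :=
  ⟨fun a => A.measurable_igw_comp hf.measurable_vec (measurable_const (a := g)) a,
    fun x a => A.igw_nonneg f hg x a, fun x => A.igw_sum f g x⟩

lemma expGap_igw_le (E : Env X K) {f : X → Fin K → ℝ} (hf : IsModel f) {g : ℝ} (hg : 0 < g) :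
    A.expGap E f (A.igw f g) ≤ K / g := by
  have h := integral_mono (A.integrable_gap E hf (A.isActionKernel_igw hf hg.le))
    (integrable_const (K / g : ℝ)) (fun x => A.sum_igw_mul_gap_le f hg x)
  simpa [expGap] using h

/-! ### Regret comparison -/

/-- Mean absolute deviation of the model `f` from the mean rewards under the kernel `q`. -/
noncomputable def meanDev (E : Env X K) (f q : X → Fin K → ℝ) : ℝ :=
  ∫ x, ∑ a, q x a * |f x a - E.fstar x a| ∂E.D.fst

lemma integrable_meanDev (E : Env X K) {f q : X → Fin K → ℝ} (hf : IsModel f)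
    (hq : IsActionKernel q) :
    Integrable (fun x => ∑ a, q x a * |f x a - E.fstar x a|) E.D.fst :=
  hq.integrable_sum_mul _ (fun a => ((hf.1 a).sub (E.fstar_measurable a)).abs)
    (fun _ _ => abs_nonneg _) fun x a => abs_sub_le_one_of_mem (hf.2 x a) (E.fstar_mem x a)

/-- Importance weighting bound: deviations under an arbitrary kernel are controlled by the squared
error under inverse gap weighting. -/
lemma meanDev_le (E : Env X K) {f f' q : X → Fin K → ℝ} (hf : IsModel f) (hf' : IsModel f')
    (hq : IsActionKernel q) {g s : ℝ} (hg : 0 ≤ g) (hs : 0 < s) :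
    meanDev E f' q ≤ s * (K + g * A.expGap E f q) + sqError E (A.igw f g) f' / (4 * s) := by
  have hK' : (0 : ℝ) < K := by exact_mod_cast A.K_pos
  have hp := A.isActionKernel_igw hf hg
  have hi1 := A.integrable_gap E hf hq
  have hi2 := integrable_sqError E hp hf'
  have key : ∀ x, ∑ a, q x a * |f' x a - E.fstar x a| ≤
      s * (K + g * ∑ a, q x a * A.gap f x a) +
        (∑ a, A.igw f g x a * (f' x a - E.fstar x a) ^ 2) / (4 * s) := fun x => by
    have h : ∀ a ∈ Finset.univ, q x a * |f' x a - E.fstar x a| ≤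
        (s * K) * q x a + (s * g) * (q x a * A.gap f x a) +
          A.igw f g x a * (f' x a - E.fstar x a) ^ 2 / (4 * s) := fun a _ => by
      set Δ := |f' x a - E.fstar x a| with hΔ
      have hq0 := hq.2.1 x a
      have hq1 := hq.le_one x a
      set w := (K : ℝ) + g * A.gap f x a with hw
      have hw0 : 0 < w := by
        have := mul_nonneg hg (A.gap_nonneg f x a)
        positivity
      have hpw : 1 / w ≤ A.igw f g x a := A.one_div_le_igw f hg x a
      -- AM–GM with weight `w`, the inverse of the guaranteed probability of the arm. In the
      -- quadratic term `q ≤ 1` is dropped and `1 / w` is replaced by the actual probability, which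
      -- produces the squared error.
      have h1 : Δ ≤ s * w + (1 / w) * Δ ^ 2 / (4 * s) := by
        have h2 : 0 ≤ (2 * s * w - Δ) ^ 2 / (4 * s * w) := by positivity
        have h3 : (2 * s * w - Δ) ^ 2 / (4 * s * w) = s * w + (1 / w) * Δ ^ 2 / (4 * s) - Δ := by
          field_simp; ring
        linarith
      have h4 : (1 / w) * Δ ^ 2 / (4 * s) ≤
          A.igw f g x a * (f' x a - E.fstar x a) ^ 2 / (4 * s) := by
        rw [← sq_abs (f' x a - E.fstar x a), ← hΔ]
        gcongr
      have h5 : 0 ≤ (1 / w) * Δ ^ 2 / (4 * s) := by positivity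
      calc q x a * Δ ≤ q x a * (s * w + (1 / w) * Δ ^ 2 / (4 * s)) :=
            mul_le_mul_of_nonneg_left h1 hq0
        _ = q x a * (s * w) + q x a * ((1 / w) * Δ ^ 2 / (4 * s)) := by ring
        _ ≤ q x a * (s * w) + 1 * ((1 / w) * Δ ^ 2 / (4 * s)) := by gcongr
        _ ≤ q x a * (s * w) + A.igw f g x a * (f' x a - E.fstar x a) ^ 2 / (4 * s) := by
            rw [one_mul]; gcongr
        _ = _ := by rw [hw]; ring
    refine (Finset.sum_le_sum h).trans (le_of_eq ?_)
    rw [Finset.sum_add_distrib, Finset.sum_add_distrib, ← Finset.mul_sum, ← Finset.mul_sum,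
      ← Finset.sum_div, hq.2.2 x]
    ring
  have hi3 : Integrable (fun x => (K : ℝ) + g * ∑ a, q x a * A.gap f x a) E.D.fst :=
    (integrable_const _).add (hi1.const_mul g)
  have hi4 : Integrable (fun x => s * (K + g * ∑ a, q x a * A.gap f x a) +
      (∑ a, A.igw f g x a * (f' x a - E.fstar x a) ^ 2) / (4 * s)) E.D.fst :=
    (hi3.const_mul s).add (hi2.div_const _)
  refine (integral_mono (integrable_meanDev E hf' hq) hi4 key).trans (le_of_eq ?_)
  rw [integral_add (hi3.const_mul s) (hi2.div_const (4 * s)), integral_const_mul,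
    integral_add (integrable_const _) (hi1.const_mul g), integral_const_mul, integral_div]
  simp [expGap, sqError]

/-- The maximum of `g` is at least its value at the greedy arm of `f`, so the maxima differ by at
most the deviation at that one arm; the averages over `q` differ by the deviation under `q`. -/
lemma sum_mul_gap_sub_le {q : X → Fin K → ℝ} (hq : IsActionKernel q) (f g : X → Fin K → ℝ)
    (x : X) : ∑ a, q x a * A.gap f x a - ∑ a, q x a * A.gap g x a ≤
      ∑ a, A.greedyKernel f x a * |f x a - g x a| + ∑ a, q x a * |f x a - g x a| := by
  have h1 : ∑ a, A.greedyKernel f x a * |f x a - g x a| =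
      |f x (A.greedy (f x)) - g x (A.greedy (f x))| := by simp [greedyKernel]
  have h2 : ∀ h : X → Fin K → ℝ, ∑ a, q x a * A.gap h x a =
      h x (A.greedy (h x)) - ∑ a, q x a * h x a := fun h => by
    simp only [gap, mul_sub, Finset.sum_sub_distrib]
    rw [← Finset.sum_mul, hq.2.2 x, one_mul]
  have h3 : ∑ a, q x a * g x a - ∑ a, q x a * f x a ≤ ∑ a, q x a * |f x a - g x a| := by
    rw [← Finset.sum_sub_distrib]
    refine Finset.sum_le_sum fun a _ => ?_
    rw [← mul_sub, abs_sub_comm]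
    exact mul_le_mul_of_nonneg_left (le_abs_self _) (hq.2.1 x a)
  rw [h1, h2, h2]
  have h4 := A.greedy_max (g x) (A.greedy (f x))
  linarith [le_abs_self (f x (A.greedy (f x)) - g x (A.greedy (f x)))]

lemma expGap_model_sub_le (E : Env X K) {f q : X → Fin K → ℝ} (hf : IsModel f)
    (hq : IsActionKernel q) : A.expGap E f q - A.expGap E E.fstar q ≤
      meanDev E f (A.greedyKernel f) + meanDev E f q := by
  have hk := A.isActionKernel_greedyKernel hf
  unfold expGap meanDev
  rw [← integral_sub (A.integrable_gap E hf hq) (A.integrable_gap E E.isModel_fstar hq),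
    ← integral_add (integrable_meanDev E hf hk) (integrable_meanDev E hf hq)]
  exact integral_mono
    ((A.integrable_gap E hf hq).sub (A.integrable_gap E E.isModel_fstar hq))
    ((integrable_meanDev E hf hk).add (integrable_meanDev E hf hq))
    fun x => A.sum_mul_gap_sub_le hq f E.fstar x

lemma expGap_fstar_sub_le (E : Env X K) {f q : X → Fin K → ℝ} (hf : IsModel f)
    (hq : IsActionKernel q) : A.expGap E E.fstar q - A.expGap E f q ≤
      meanDev E f (A.greedyKernel E.fstar) + meanDev E f q := by
  have hk := A.isActionKernel_greedyKernel E.isModel_fstar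
  unfold expGap meanDev
  rw [← integral_sub (A.integrable_gap E E.isModel_fstar hq) (A.integrable_gap E hf hq),
    ← integral_add (integrable_meanDev E hf hk) (integrable_meanDev E hf hq)]
  refine integral_mono
    ((A.integrable_gap E E.isModel_fstar hq).sub (A.integrable_gap E hf hq))
    ((integrable_meanDev E hf hk).add (integrable_meanDev E hf hq)) fun x => ?_
  simpa only [abs_sub_comm] using A.sum_mul_gap_sub_le hq E.fstar f x

/-- The true and the estimated expected gaps of every kernel agree up to a factor two and the
additive error `c`. -/
def GapsComparable (E : Env X K) (f : X → Fin K → ℝ) (c : ℝ) : Prop :=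
  ∀ q, IsActionKernel q → A.expGap E E.fstar q ≤ 2 * A.expGap E f q + c ∧
    A.expGap E f q ≤ 2 * A.expGap E E.fstar q + c

lemma gapsComparable_of_one_le (E : Env X K) {f : X → Fin K → ℝ} (hf : IsModel f) {c : ℝ}
    (hc : 1 ≤ c) : A.GapsComparable E f c := fun q hq => by
  have h1 := A.expGap_le_one E hf hq
  have h2 := A.expGap_le_one E E.isModel_fstar hq
  have h3 := A.expGap_nonneg E f hq
  have h4 := A.expGap_nonneg E E.fstar hq
  constructor <;> linarith

variable {A} in
lemma GapsComparable.mono {E : Env X K} {f : X → Fin K → ℝ} {c c' : ℝ}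
    (h : A.GapsComparable E f c) (hc : c ≤ c') : A.GapsComparable E f c' := fun q hq =>
  ⟨(h q hq).1.trans (by linarith), (h q hq).2.trans (by linarith)⟩

variable {A} in
/-- One step of the recursion over the epochs: if data are collected by inverse gap weighting for
`f` and `f'` has squared error at most `e` on them, the comparability of gaps passes to `f'`. -/
lemma GapsComparable.step {E : Env X K} {f f' : X → Fin K → ℝ} {c g e : ℝ}
    (h : A.GapsComparable E f c) (hf : IsModel f) (hf' : IsModel f') (hg : 0 < g)
    (he : sqError E (A.igw f g) f' ≤ e) :
    A.GapsComparable E f' (c / 4 + 4 * (K / (16 * g) + 4 * e * g)) := by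
  set B := (K : ℝ) / (16 * g) + 4 * e * g with hB
  have hdev : ∀ q, IsActionKernel q → meanDev E f' q ≤ A.expGap E f q / 16 + B := fun q hq => by
    -- This `s` gives the estimated gap of `q` the coefficient `s * g = 1 / 16`, small enough for
    -- the true gap to be absorbed on the left below.
    have h1 := A.meanDev_le E hf hf' hq hg.le (s := 1 / (16 * g)) (by positivity)
    have h2 : sqError E (A.igw f g) f' / (4 * (1 / (16 * g))) ≤ e / (4 * (1 / (16 * g))) := by
      gcongr
    refine (h1.trans (add_le_add_right h2 _)).trans (le_of_eq ?_)
    rw [hB]; field_simp; ring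
  have hks := A.isActionKernel_greedyKernel E.isModel_fstar
  have hk := A.isActionKernel_greedyKernel hf'
  have hc0 : 0 ≤ c := by
    have h0 := (h _ hks).2
    rw [A.expGap_greedyKernel] at h0
    linarith [A.expGap_nonneg E f hks]
  have hB0 : 0 ≤ B := by
    have := (sqError_nonneg E (A.isActionKernel_igw hf hg.le) f').trans he
    positivity
  -- The optimal kernel has no regret, so its `f`-gap is at most `c`, while the `f`-gap of `q` is at
  -- most twice its regret plus `c`. This leaves an eighth of the regret of `q` on the right, which
  -- moves to the left.
  have h1 : ∀ q, IsActionKernel q →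
      A.expGap E E.fstar q ≤ 2 * A.expGap E f' q + (c / 4 + 4 * B) := fun q hq => by
    have a1 := A.expGap_fstar_sub_le E hf' hq
    have a2 := hdev _ hks
    have a3 := hdev _ hq
    have a4 := (h _ hks).2
    rw [A.expGap_greedyKernel] at a4
    have a5 := (h _ hq).2
    have a6 := A.expGap_nonneg E f' hq
    linarith
  refine fun q hq => ⟨h1 q hq, ?_⟩
  have a1 := A.expGap_model_sub_le E hf' hq
  have a2 := hdev _ hk
  have a3 := hdev _ hq
  have a4 := (h _ hk).2
  have a5 := (h _ hq).2
  -- The greedy kernel of `f'` has no `f'`-gap, so the first half already bounds its regret by the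
  -- new error.
  have a6 := h1 _ hk
  rw [A.expGap_greedyKernel] at a6
  have a7 := A.expGap_nonneg E E.fstar hq
  linarith

end Inputs

end ContextualBandit

/-! ### Conditional laws through rectangles -/

namespace MeasureTheory

/-- The densities `u` and `v` define measures that coincide on the smaller σ-algebra, and integrals
of functions measurable for it see nothing else. -/
lemma lintegral_mul_eq_of_setLIntegral_eq {Ω : Type*} {m mΩ : MeasurableSpace Ω} (hm : m ≤ mΩ)
    {P : Measure Ω} {u v h : Ω → ENNReal} (hu : Measurable u) (hv : Measurable v)
    (huv : ∀ G, MeasurableSet[m] G → ∫⁻ ω in G, u ω ∂P = ∫⁻ ω in G, v ω ∂P)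
    (hh : Measurable[m] h) : ∫⁻ ω, h ω * u ω ∂P = ∫⁻ ω, h ω * v ω ∂P := by
  have key : (P.withDensity u).trim hm = (P.withDensity v).trim hm := by
    refine @Measure.ext _ m _ _ fun G hG => ?_
    rw [trim_measurableSet_eq hm hG, trim_measurableSet_eq hm hG,
      withDensity_apply _ (hm _ hG), withDensity_apply _ (hm _ hG), huv G hG]
  have h1 : ∀ w : Ω → ENNReal, Measurable w →
      ∫⁻ ω, h ω * w ω ∂P = ∫⁻ ω, h ω ∂(P.withDensity w).trim hm := fun w hw => by
    rw [lintegral_trim hm hh, lintegral_withDensity_eq_lintegral_mul _ hw (hh.mono hm le_rfl)]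
    simp only [Pi.mul_apply, mul_comm]
  rw [h1 u hu, h1 v hv, key]

/-- If the conditional law of `Y` given `θ` is `κ ∘ θ` on a generating π-system, then `κ ∘ θ`
computes the probabilities of all measurable events in `(θ, Y)`. -/
lemma measure_prodMk_mem_eq_lintegral {Ω Θ Y : Type*} {mΩ : MeasurableSpace Ω}
    {mΘ : MeasurableSpace Θ} {mY : MeasurableSpace Y} {P : Measure Ω} [IsFiniteMeasure P]
    {θ : Ω → Θ} (hθ : Measurable θ) {y : Ω → Y} (hy : Measurable y) (κ : Kernel Θ Y)
    [IsMarkovKernel κ] {C : Set (Set Y)} (hC : mY = MeasurableSpace.generateFrom C)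
    (hpi : IsPiSystem C)
    (h : ∀ G, MeasurableSet G → ∀ B ∈ C, P (θ ⁻¹' G ∩ y ⁻¹' B) = ∫⁻ ω in θ ⁻¹' G, κ (θ ω) B ∂P)
    {U : Set (Θ × Y)} (hU : MeasurableSet U) :
    P {ω | (θ ω, y ω) ∈ U} = ∫⁻ ω, κ (θ ω) (Prod.mk (θ ω) ⁻¹' U) ∂P := by
  have hκθ : Measurable fun ω => κ (θ ω) := κ.measurable.comp hθ
  -- For fixed `G` both sides are finite measures of equal mass, so agreement on the π-system `C`
  -- suffices.
  have h1 : ∀ G, MeasurableSet G →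
      (P.restrict (θ ⁻¹' G)).map y = (P.restrict (θ ⁻¹' G)).bind fun ω => κ (θ ω) := fun G hG => by
    refine ext_of_generate_finite C hC hpi (fun B hB => ?_) ?_
    · have hB' : MeasurableSet B := hC ▸ MeasurableSpace.measurableSet_generateFrom hB
      rw [Measure.map_apply hy hB', Measure.restrict_apply (hy hB'),
        Measure.bind_apply hB' hκθ.aemeasurable, Set.inter_comm, h G hG B hB]
    · rw [Measure.map_apply hy .univ, Measure.bind_apply .univ hκθ.aemeasurable]
      simp
  have h2 : P.map (fun ω => (θ ω, y ω)) = (P.map θ) ⊗ₘ κ := by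
    refine Measure.ext_prod fun {G B} hG hB => ?_
    rw [Measure.map_apply (hθ.prodMk hy) (hG.prod hB), Measure.compProd_apply_prod hG hB,
      setLIntegral_map hG (κ.measurable_coe hB) hθ]
    have h3 := congrArg (fun μ => μ B) (h1 G hG)
    simp only [Measure.bind_apply hB hκθ.aemeasurable, Measure.map_apply hy hB,
      Measure.restrict_apply (hy hB)] at h3
    rw [← h3, Set.inter_comm]
    rfl
  have h4 := congrArg (fun μ => μ U) h2
  simp only [Measure.map_apply (hθ.prodMk hy) hU, Measure.compProd_apply hU] at h4
  rw [lintegral_map (Kernel.measurable_kernel_prodMk_left hU) hθ] at h4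
  exact h4

end MeasureTheory

namespace ContextualBandit

namespace Inputs

variable {X S : Type*} [MeasurableSpace X] [MeasurableSpace S] {K : ℕ} (A : Inputs X S K)

/-! ### The epoch schedule -/

lemma τ_pos {m : ℕ} (hm : 1 ≤ m) : 0 < A.τ m := by
  obtain ⟨n, rfl⟩ := Nat.exists_eq_add_of_le' hm
  have := A.two_le_τ₁
  simp only [τ]
  positivity

lemma τ_succ {m : ℕ} (hm : 1 ≤ m) : A.τ (m + 1) = 2 * A.τ m := by
  obtain ⟨n, rfl⟩ := Nat.exists_eq_add_of_le' hm
  simp only [τ]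
  ring

lemma τ_mono : Monotone A.τ := by
  refine monotone_nat_of_le_succ fun m => ?_
  rcases Nat.eq_zero_or_pos m with rfl | hm
  · simp [τ]
  · rw [A.τ_succ hm]; omega

lemma len_one : A.len 1 = A.τ₁ := by simp [len, τ]

lemma len_add_two (m : ℕ) : A.len (m + 2) = 2 ^ m * A.τ₁ := by
  have h : 2 ^ (m + 1) * A.τ₁ = 2 ^ m * A.τ₁ + 2 ^ m * A.τ₁ := by ring
  simp only [len, Nat.add_succ_sub_one, τ, h, Nat.add_sub_cancel]

lemma two_le_len {m : ℕ} (hm : 1 ≤ m) : 2 ≤ A.len m := by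
  have := A.two_le_τ₁
  match m, hm with
  | 1, _ => rwa [len_one]
  | m + 2, _ => rw [len_add_two]; nlinarith [Nat.one_le_two_pow (n := m)]

lemma τ_pred_add_len (m : ℕ) : A.τ (m - 1) + A.len m = A.τ m :=
  Nat.add_sub_of_le (A.τ_mono (Nat.sub_le m 1))

lemma exists_le_τ (t : ℕ) : ∃ m, t ≤ A.τ m :=
  ⟨t + 1, by
    have := A.two_le_τ₁
    have h : t < 2 ^ t := Nat.lt_two_pow_self
    simp only [τ]
    nlinarith⟩

lemma le_τ_epoch (t : ℕ) : t ≤ A.τ (A.epoch t) :=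
  Nat.sInf_mem (s := {m | t ≤ A.τ m}) (A.exists_le_τ t)

lemma epoch_le {t m : ℕ} (h : t ≤ A.τ m) : A.epoch t ≤ m := Nat.sInf_le h

lemma one_le_epoch {t : ℕ} (ht : 1 ≤ t) : 1 ≤ A.epoch t := by
  by_contra h
  have h0 : A.epoch t = 0 := by omega
  have := A.le_τ_epoch t
  rw [h0] at this
  simp only [τ] at this
  omega

lemma τ_pred_epoch_lt {t : ℕ} (ht : 1 ≤ t) : A.τ (A.epoch t - 1) < t := by
  by_contra h
  have h1 := A.epoch_le (not_lt.1 h)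
  have h2 := A.one_le_epoch ht
  omega

lemma epoch_eq {t m : ℕ} (h1 : A.τ (m - 1) < t) (h2 : t ≤ A.τ m) : A.epoch t = m := by
  refine le_antisymm (A.epoch_le h2) ?_
  by_contra h
  have := A.τ_mono (show A.epoch t ≤ m - 1 by omega)
  have := A.le_τ_epoch t
  omega

/-! ### Measurability of the run -/

section Measurability

lemma measurable_sample : Measurable fun y : Round X S K => (y.1, y.2.2.1, y.2.1 y.2.2.1) :=
  measurable_fst.prodMk ((measurable_fst.comp (measurable_snd.comp measurable_snd)).prodMk
    (measurable_eval (measurable_fst.comp measurable_snd)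
      (measurable_fst.comp (measurable_snd.comp measurable_snd))))

variable {Ω : Type*} {mΩ : MeasurableSpace Ω} {z : ℕ → Ω → Round X S K}

lemma measurable_data {m : ℕ} (hz : ∀ t, 1 ≤ t → t ≤ A.τ m → Measurable (z t)) :
    Measurable fun ω => A.data (fun s => z s ω) m := by
  refine measurable_pi_lambda _ fun k => measurable_sample.comp (hz _ (by omega) ?_)
  have := A.τ_pred_add_len m
  omega

lemma measurable_seed {m : ℕ} (hm : 1 ≤ m)
    (hz : ∀ t, 1 ≤ t → t ≤ A.τ m → Measurable (z t)) :
    Measurable fun ω => A.seed (fun s => z s ω) m :=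
  (measurable_snd.comp (measurable_snd.comp measurable_snd)).comp (hz _ (A.τ_pos hm) le_rfl)

lemma measurable_test {m : ℕ} (hm : 1 ≤ m) (i : ℕ) (ζ : ℝ)
    (hz : ∀ t, 1 ≤ t → t ≤ A.τ m → Measurable (z t)) :
    Measurable fun ω => A.test (fun s => z s ω) i m ζ :=
  (A.mt_measurable i _ ζ).comp ((A.measurable_data hz).prodMk (A.measurable_seed hm hz))

lemma measurable_fhat {m : ℕ} (hz : ∀ t, 1 ≤ t → t ≤ A.τ (m - 1) → Measurable (z t)) :
    Measurable fun q : Ω × X => A.fhat (fun s => z s q.1) m q.2 := by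
  match m with
  | 0 => exact measurable_const
  | 1 => exact measurable_const
  | m + 2 =>
    have h : Measurable fun q : Ω × X => ((A.data (fun s => z s q.1) (m + 1),
        A.seed (fun s => z s q.1) (m + 1)), q.2) :=
      (((A.measurable_data hz).prodMk (A.measurable_seed (by omega) hz)).comp
        measurable_fst).prodMk measurable_snd
    exact measurable_pi_lambda _ fun a => (A.est_measurable A.M (A.len (m + 1)) a).comp h

lemma indexSet_subset (h : ℕ → Round X S K) (m : ℕ) : A.indexSet h m ⊆ Finset.Icc 1 A.M := by
  induction m with
  | zero => exact subset_rfl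
  | succ m ih =>
    match m with
    | 0 => exact subset_rfl
    | m + 1 => exact (Finset.filter_subset _ _).trans ih

lemma measurableSet_mem_indexSet (i : ℕ) {m : ℕ}
    (hz : ∀ t, 1 ≤ t → t ≤ A.τ (m - 1) → Measurable (z t)) :
    MeasurableSet {ω | i ∈ A.indexSet (fun s => z s ω) m} := by
  induction m with
  | zero => exact .const _
  | succ m ih =>
    match m with
    | 0 => exact .const _
    | m + 1 =>
      simp only [indexSet, Finset.mem_filter]
      exact (ih fun t h1 h2 => hz t h1 (h2.trans (A.τ_mono (by omega)))).inter
        ((A.measurable_test (by omega) i _ hz) (measurableSet_singleton false))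

/-- This form expresses the level sets of the index through finitely many membership events, whose
measurability is known. The second alternative is the convention for an empty index set. -/
lemma index_eq_iff (h : ℕ → Round X S K) (m i : ℕ) : A.index h m = i ↔
    (i ∈ A.indexSet h m ∧ ∀ j ∈ Finset.range i, j ∉ A.indexSet h m) ∨
      ((∀ j ∈ Finset.Icc 1 A.M, j ∉ A.indexSet h m) ∧ A.M = i) := by
  unfold index
  split_ifs with hI
  · constructor
    · rintro rfl
      refine Or.inl ⟨Finset.min'_mem _ _, fun j hj hj' => ?_⟩
      exact absurd (Finset.min'_le _ _ hj') (not_le.2 (Finset.mem_range.1 hj))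
    · rintro (⟨h1, h2⟩ | ⟨h1, -⟩)
      · refine le_antisymm (Finset.min'_le _ _ h1) ?_
        by_contra hlt
        exact h2 _ (Finset.mem_range.2 (not_le.1 hlt)) (Finset.min'_mem _ _)
      · obtain ⟨j, hj⟩ := hI
        exact absurd hj (h1 j (A.indexSet_subset h m hj))
  · rw [Finset.not_nonempty_iff_eq_empty] at hI
    simp [hI]

lemma measurable_index {m : ℕ} (hz : ∀ t, 1 ≤ t → t ≤ A.τ (m - 1) → Measurable (z t)) :
    Measurable fun ω => A.index (fun s => z s ω) m := by
  refine measurable_to_countable' fun i => ?_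
  have h := fun j => A.measurableSet_mem_indexSet j hz
  have h1 : (fun ω => A.index (fun s => z s ω) m) ⁻¹' {i} =
      ({ω | i ∈ A.indexSet (fun s => z s ω) m} ∩
        ⋂ j ∈ Finset.range i, {ω | j ∈ A.indexSet (fun s => z s ω) m}ᶜ) ∪
      ((⋂ j ∈ Finset.Icc 1 A.M, {ω | j ∈ A.indexSet (fun s => z s ω) m}ᶜ) ∩ {_ω | A.M = i}) := by
    ext ω
    simp only [Set.mem_preimage, Set.mem_singleton_iff, index_eq_iff, Set.mem_union, Set.mem_inter_iff,
      Set.mem_iInter, Set.mem_compl_iff, Set.mem_ofPred_eq]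
  rw [h1]
  exact ((h i).inter (Finset.measurableSet_biInter _ fun j _ => (h j).compl)).union
    ((Finset.measurableSet_biInter _ fun j _ => (h j).compl).inter (.const _))

lemma measurable_γ {m : ℕ} (hz : ∀ t, 1 ≤ t → t ≤ A.τ (m - 1) → Measurable (z t)) :
    Measurable fun ω => A.γ (fun s => z s ω) m := by
  match m with
  | 0 => exact measurable_const
  | 1 => exact measurable_const
  | m + 2 => exact (measurable_of_countable (A.γSucc (m + 1))).comp (A.measurable_index hz)

lemma measurable_kernel {m : ℕ} (hz : ∀ t, 1 ≤ t → t ≤ A.τ (m - 1) → Measurable (z t))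
    (a : Fin K) : Measurable fun q : Ω × X => A.kernel (fun s => z s q.1) m q.2 a :=
  A.measurable_igw_comp (f := fun q : Ω × X => A.fhat (fun s => z s q.1) m)
    (g := fun q => A.γ (fun s => z s q.1) m) (A.measurable_fhat hz)
    ((A.measurable_γ hz).comp measurable_fst) a

end Measurability

lemma isModel_fhat (h : ℕ → Round X S K) (m : ℕ) : IsModel (A.fhat h m) := by
  match m with
  | 0 => exact ⟨fun _ => measurable_const, fun _ _ => by simp [fhat]⟩
  | 1 => exact ⟨fun _ => measurable_const, fun _ _ => by simp [fhat]⟩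
  | m + 2 =>
    have hm : Measurable fun x : X => ((A.data h (m + 1), A.seed h (m + 1)), x) :=
      measurable_const.prodMk measurable_id
    exact ⟨fun a => (A.est_measurable A.M (A.len (m + 1)) a).comp hm,
      fun _ _ => A.est_mem _ _ _ _ _ _⟩

lemma γ_nonneg (h : ℕ → Round X S K) (m : ℕ) : 0 ≤ A.γ h m := by
  match m with
  | 0 => exact zero_le_one
  | 1 => exact zero_le_one
  | m + 2 => exact Real.sqrt_nonneg _

lemma isActionKernel_kernel (h : ℕ → Round X S K) (m : ℕ) : IsActionKernel (A.kernel h m) :=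
  A.isActionKernel_igw (A.isModel_fhat h m) (A.γ_nonneg h m)

/-! ### The law of one round -/

variable {A}

lemma _root_.ContextualBandit.IsActionKernel.sum_ofReal {p : X → Fin K → ℝ}
    (hp : IsActionKernel p) (x : X) : ∑ a, ENNReal.ofReal (p x a) = 1 := by
  rw [← ENNReal.ofReal_sum_of_nonneg fun a _ => hp.2.1 x a, hp.2.2 x, ENNReal.ofReal_one]

lemma lintegral_stepLaw (E : Env X K) {p : X → Fin K → ℝ} (hp : IsActionKernel p)
    {φ : Round X S K → ENNReal} (hφ : Measurable φ) :
    ∫⁻ y, φ y ∂A.stepLaw E p = ∑ a, ∫⁻ q, ENNReal.ofReal (p q.1.1 a) *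
      φ (q.1.1, q.1.2, a, q.2) ∂(E.D.prod A.seedLaw) := by
  unfold stepLaw
  rw [lintegral_finsetSum_measure]
  refine Finset.sum_congr rfl fun a _ => ?_
  have hm : Measurable fun q : (X × (Fin K → ℝ)) × S => (q.1.1, q.1.2, a, q.2) := by fun_prop
  have hpa : Measurable fun e : X × (Fin K → ℝ) => ENNReal.ofReal (p e.1 a) :=
    ENNReal.measurable_ofReal.comp ((hp.1 a).comp measurable_fst)
  rw [lintegral_map hφ hm, prod_withDensity_left hpa]
  exact lintegral_withDensity_eq_lintegral_mul _ (hpa.comp measurable_fst) (hφ.comp hm)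

lemma isProbabilityMeasure_stepLaw (E : Env X K) {p : X → Fin K → ℝ} (hp : IsActionKernel p) :
    IsProbabilityMeasure (A.stepLaw E p) := by
  refine ⟨?_⟩
  rw [← lintegral_one, lintegral_stepLaw E hp measurable_const, ← lintegral_finsetSum]
  · simp [hp.sum_ofReal]
  · intro a _
    exact ((ENNReal.measurable_ofReal.comp
      ((hp.1 a).comp (measurable_fst.comp measurable_fst))).mul measurable_const)

lemma sampleLaw_apply (E : Env X K) {p : X → Fin K → ℝ} (hp : IsActionKernel p)
    {B : Set (X × Fin K × ℝ)} (hB : MeasurableSet B) :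
    sampleLaw E p B = ∑ a, ∫⁻ e, ENNReal.ofReal (p e.1 a) *
      B.indicator 1 (e.1, a, e.2 a) ∂E.D := by
  unfold sampleLaw
  rw [Measure.finsetSum_apply]
  refine Finset.sum_congr rfl fun a _ => ?_
  have hm : Measurable fun e : X × (Fin K → ℝ) => (e.1, a, e.2 a) := by fun_prop
  have hpa : Measurable fun e : X × (Fin K → ℝ) => ENNReal.ofReal (p e.1 a) :=
    ENNReal.measurable_ofReal.comp ((hp.1 a).comp measurable_fst)
  rw [← lintegral_indicator_one hB, lintegral_map (measurable_one.indicator hB) hm]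
  exact lintegral_withDensity_eq_lintegral_mul _ hpa ((measurable_one.indicator hB).comp hm)

lemma isProbabilityMeasure_sampleLaw (E : Env X K) {p : X → Fin K → ℝ}
    (hp : IsActionKernel p) : IsProbabilityMeasure (sampleLaw E p) := by
  refine ⟨?_⟩
  rw [sampleLaw_apply E hp .univ, ← lintegral_finsetSum]
  · simp [hp.sum_ofReal]
  · intro a _
    exact ((ENNReal.measurable_ofReal.comp
      ((hp.1 a).comp measurable_fst)).mul (by simp))

/-- The data point and the seed of a round are independent. -/
lemma stepLaw_sample_seed (E : Env X K) {p : X → Fin K → ℝ} (hp : IsActionKernel p)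
    {B : Set (X × Fin K × ℝ)} (hB : MeasurableSet B) {C : Set S} (hC : MeasurableSet C) :
    A.stepLaw E p {y | (y.1, y.2.2.1, y.2.1 y.2.2.1) ∈ B ∧ y.2.2.2 ∈ C} =
      sampleLaw E p B * A.seedLaw C := by
  have hBC : MeasurableSet
      {y : Round X S K | (y.1, y.2.2.1, y.2.1 y.2.2.1) ∈ B ∧ y.2.2.2 ∈ C} :=
    (measurable_sample hB).inter ((measurable_snd.comp (measurable_snd.comp measurable_snd)) hC)
  rw [← lintegral_indicator_one hBC, lintegral_stepLaw E hp (measurable_one.indicator hBC),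
    sampleLaw_apply E hp hB, Finset.sum_mul]
  refine Finset.sum_congr rfl fun a _ => ?_
  have hm : Measurable fun e : X × (Fin K → ℝ) => (e.1, a, e.2 a) := by fun_prop
  have hpa : Measurable fun e : X × (Fin K → ℝ) => ENNReal.ofReal (p e.1 a) :=
    ENNReal.measurable_ofReal.comp ((hp.1 a).comp measurable_fst)
  rw [← lintegral_indicator_one hC]
  refine Eq.trans ?_ (lintegral_prod_mul (hpa.mul ((measurable_one.indicator hB).comp hm)).aemeasurable
    (measurable_one.indicator hC).aemeasurable)
  refine lintegral_congr fun q => ?_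
  by_cases h1 : (q.1.1, a, q.1.2 a) ∈ B <;> by_cases h2 : q.2 ∈ C <;> simp [h1, h2]

lemma stepLaw_sample (E : Env X K) {p : X → Fin K → ℝ} (hp : IsActionKernel p)
    {B : Set (X × Fin K × ℝ)} (hB : MeasurableSet B) :
    A.stepLaw E p {y | (y.1, y.2.2.1, y.2.1 y.2.2.1) ∈ B} = sampleLaw E p B := by
  simpa using A.stepLaw_sample_seed E hp hB MeasurableSet.univ

lemma measurable_lintegral_stepLaw (E : Env X K) {Ω : Type*} {mΩ : MeasurableSpace Ω}
    {p : Ω → X → Fin K → ℝ} (hp : ∀ ω, IsActionKernel (p ω))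
    (hpm : ∀ a, Measurable fun q : Ω × X => p q.1 q.2 a) {φ : Round X S K → ENNReal}
    (hφ : Measurable φ) : Measurable fun ω => ∫⁻ y, φ y ∂A.stepLaw E (p ω) := by
  simp only [fun ω => lintegral_stepLaw (A := A) E (hp ω) hφ]
  refine Finset.measurable_fun_sum _ fun a _ => ?_
  refine Measurable.lintegral_prod_right' (f := fun q : Ω × ((X × (Fin K → ℝ)) × S) =>
    ENNReal.ofReal (p q.1 q.2.1.1 a) * φ (q.2.1.1, q.2.1.2, a, q.2.2)) ?_
  have h1 : Measurable fun q : Ω × ((X × (Fin K → ℝ)) × S) => (q.1, q.2.1.1) := by fun_prop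
  have h2 : Measurable fun q : Ω × ((X × (Fin K → ℝ)) × S) =>
      (q.2.1.1, q.2.1.2, a, q.2.2) := by fun_prop
  exact (ENNReal.measurable_ofReal.comp ((hpm a).comp h1)).mul (hφ.comp h2)

lemma measurable_stepLaw (E : Env X K) {Ω : Type*} {mΩ : MeasurableSpace Ω}
    {p : Ω → X → Fin K → ℝ} (hp : ∀ ω, IsActionKernel (p ω))
    (hpm : ∀ a, Measurable fun q : Ω × X => p q.1 q.2 a) :
    Measurable fun ω => A.stepLaw E (p ω) := by
  refine Measure.measurable_of_measurable_coe _ fun B hB => ?_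
  simp only [← lintegral_indicator_one hB]
  exact measurable_lintegral_stepLaw E hp hpm (measurable_one.indicator hB)

end Inputs

end ContextualBandit

namespace ContextualBandit

namespace Inputs

variable {X S : Type*} [MeasurableSpace X] [MeasurableSpace S] {K : ℕ} {A : Inputs X S K}

/-! ### Conditional laws along a run -/

namespace IsRun

variable {Ω : Type*} {mΩ : MeasurableSpace Ω} {E : Env X K} {P : Measure Ω}
  {ℱ : Filtration ℕ mΩ} {z : ℕ → Ω → Round X S K}

lemma measurable_of_le (hz : A.IsRun E P ℱ z) {s t : ℕ} (ht : 1 ≤ t) (hts : t ≤ s) :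
    Measurable[ℱ s] (z t) :=
  (hz.adapted t ht).mono (ℱ.mono hts) le_rfl

lemma measurable_round (hz : A.IsRun E P ℱ z) {t : ℕ} (ht : 1 ≤ t) : Measurable (z t) :=
  (hz.adapted t ht).mono (ℱ.le t) le_rfl

lemma measurable_lintegral_kernel (hz : A.IsRun E P ℱ z) {s m : ℕ} (hs : A.τ (m - 1) ≤ s)
    {φ : Round X S K → ENNReal} (hφ : Measurable φ) :
    Measurable[ℱ s] fun ω => ∫⁻ y, φ y ∂A.stepLaw E (A.kernel (fun s => z s ω) m) :=
  measurable_lintegral_stepLaw (mΩ := ℱ s) E (fun _ => A.isActionKernel_kernel _ m)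
    (A.measurable_kernel (mΩ := ℱ s) fun _ h1 h2 => hz.measurable_of_le h1 (h2.trans hs)) hφ

/-- The conditional law of round `t + 1`, in terms of functions. -/
lemma lintegral_mul (hz : A.IsRun E P ℱ z) (t : ℕ) {h : Ω → ENNReal} (hh : Measurable[ℱ t] h)
    {φ : Round X S K → ENNReal} (hφ : Measurable φ) :
    ∫⁻ ω, h ω * φ (z (t + 1) ω) ∂P = ∫⁻ ω, h ω *
      ∫⁻ y, φ y ∂A.stepLaw E (A.kernel (fun s => z s ω) (A.epoch (t + 1))) ∂P := by
  -- The kernel of the epoch of round `t + 1` uses only rounds up to the end of the previous epoch,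
  -- hence is known at time `t`.
  have hle : A.τ (A.epoch (t + 1) - 1) ≤ t :=
    Nat.lt_succ_iff.1 (A.τ_pred_epoch_lt (Nat.le_add_left 1 t))
  have hzt := hz.measurable_round (Nat.le_add_left 1 t)
  have hκ : Measurable fun ω =>
      A.stepLaw E (A.kernel (fun s => z s ω) (A.epoch (t + 1))) :=
    measurable_stepLaw E (fun ω => A.isActionKernel_kernel _ _)
      (A.measurable_kernel fun _ h1 _ => hz.measurable_round h1)
  refine lintegral_mul_eq_of_setLIntegral_eq (ℱ.le t) (hφ.comp hzt)
    ((hz.measurable_lintegral_kernel hle hφ).mono (ℱ.le t) le_rfl) (fun G hG => ?_) hh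
  have key : (P.restrict G).map (z (t + 1)) = (P.restrict G).bind fun ω =>
      A.stepLaw E (A.kernel (fun s => z s ω) (A.epoch (t + 1))) := by
    ext B hB
    rw [Measure.map_apply hzt hB, Measure.restrict_apply (hzt hB),
      Measure.bind_apply hB hκ.aemeasurable, Set.inter_comm, hz.law t G hG B hB]
  rw [← Measure.lintegral_bind hκ.aemeasurable hφ.aemeasurable, ← key, lintegral_map hφ hzt]

/-- Conditionally on the earlier epochs, the rounds of epoch `m` are independent draws from the
one-round law of that epoch. -/
lemma lintegral_mul_prod (hz : A.IsRun E P ℱ z) {m : ℕ} {B : ℕ → Set (Round X S K)}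
    (hB : ∀ k, MeasurableSet (B k)) {n : ℕ} (hn : n ≤ A.len m) {h : Ω → ENNReal}
    (hh : Measurable[ℱ (A.τ (m - 1))] h) :
    ∫⁻ ω, h ω * ∏ k ∈ Finset.range n, (B k).indicator 1 (z (A.τ (m - 1) + k + 1) ω) ∂P =
      ∫⁻ ω, h ω * ∏ k ∈ Finset.range n, A.stepLaw E (A.kernel (fun s => z s ω) m) (B k) ∂P := by
  induction n generalizing h with
  | zero => simp
  | succ n ih =>
    have hep : A.epoch (A.τ (m - 1) + n + 1) = m := by
      refine A.epoch_eq (by omega) ?_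
      have := A.τ_pred_add_len m
      omega
    have hκ : Measurable[ℱ (A.τ (m - 1))] fun ω =>
        A.stepLaw E (A.kernel (fun s => z s ω) m) (B n) := by
      simpa only [lintegral_indicator_one (hB n)] using
        hz.measurable_lintegral_kernel le_rfl (measurable_one.indicator (hB n))
    have hw : Measurable[ℱ (A.τ (m - 1) + n)] fun ω => h ω *
        ∏ k ∈ Finset.range n, (B k).indicator 1 (z (A.τ (m - 1) + k + 1) ω) := by
      refine (hh.mono (ℱ.mono (Nat.le_add_right _ _)) le_rfl).mul
        (Finset.measurable_fun_prod _ fun k hk => ?_)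
      have := Finset.mem_range.1 hk
      exact (measurable_one.indicator (hB k)).comp (hz.measurable_of_le (by omega) (by omega))
    have h1 := hz.lintegral_mul _ hw (measurable_one.indicator (hB n))
    simp only [hep, lintegral_indicator_one (hB n)] at h1
    -- The last round has been integrated out. Its factor is determined at the start of the epoch
    -- and can join the weight `h`, which is why the induction runs over all `h`.
    have h2 := ih (by omega) (hh.mul hκ)
    simp only [Finset.prod_range_succ, Pi.mul_apply] at h1 h2 ⊢
    calc _ = _ := by simp only [← mul_assoc]
      _ = _ := h1
      _ = _ := by simp only [mul_right_comm]
      _ = _ := h2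
      _ = _ := by simp only [mul_assoc, mul_comm]

lemma measure_inter_data_seed (hz : A.IsRun E P ℱ z) {m : ℕ} (hm : 1 ≤ m) {G : Set Ω}
    (hG : MeasurableSet[ℱ (A.τ (m - 1))] G) {B : Fin (A.len m) → Set (X × Fin K × ℝ)}
    (hB : ∀ k, MeasurableSet (B k)) {C : Set S} (hC : MeasurableSet C) :
    P (G ∩ {ω | A.data (fun s => z s ω) m ∈ Set.univ.pi B ∧ A.seed (fun s => z s ω) m ∈ C}) =
      ∫⁻ ω in G, (∏ k, sampleLaw E (A.kernel (fun s => z s ω) m) (B k)) * A.seedLaw C ∂P := by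
  have hlen := A.two_le_len hm
  have hτ := A.τ_pred_add_len m
  obtain ⟨n, hn⟩ : ∃ n, A.len m = n + 1 := ⟨A.len m - 1, by omega⟩
  -- One event per round: every round of the epoch constrains its data point, and only the last one,
  -- `k = n`, also constrains the seed, because the oracles read the seed of round `τ m`.
  set B' : ℕ → Set (Round X S K) := fun k => if hk : k < A.len m then
    (if k = n then {y | (y.1, y.2.2.1, y.2.1 y.2.2.1) ∈ B ⟨k, hk⟩ ∧ y.2.2.2 ∈ C} else
      {y | (y.1, y.2.2.1, y.2.1 y.2.2.1) ∈ B ⟨k, hk⟩}) else Set.univ with hB'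
  have hms : ∀ k, MeasurableSet {y : Round X S K | (y.1, y.2.2.1, y.2.1 y.2.2.1) ∈ B k} :=
    fun k => measurable_sample (hB k)
  have hB'm : ∀ k, MeasurableSet (B' k) := fun k => by
    simp only [hB']
    split_ifs
    · exact (hms _).inter ((measurable_snd.comp (measurable_snd.comp measurable_snd)) hC)
    · exact hms _
    · exact .univ
  have hGm := ℱ.le _ _ hG
  have hind : Measurable[ℱ (A.τ (m - 1))] (G.indicator fun _ => (1 : ENNReal)) :=
    measurable_const.indicator hG
  have h1 := hz.lintegral_mul_prod hB'm (le_refl (A.len m)) (h := G.indicator fun _ => 1)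
    hind
  have hmem : ∀ ω, (∀ k ∈ Finset.range (A.len m), z (A.τ (m - 1) + k + 1) ω ∈ B' k) ↔
      A.data (fun s => z s ω) m ∈ Set.univ.pi B ∧ A.seed (fun s => z s ω) m ∈ C := fun ω => by
    have hlast : A.τ (m - 1) + n + 1 = A.τ m := by omega
    constructor
    · intro h
      refine ⟨fun k _ => ?_, ?_⟩
      · have := h k (Finset.mem_range.2 k.2)
        simp only [hB', k.2, dif_pos] at this
        split_ifs at this
        · exact this.1
        · exact this
      · have := h n (Finset.mem_range.2 (by omega))
        rw [hlast] at this
        simp only [hB', show n < A.len m by omega, dif_pos, if_pos] at this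
        exact this.2
    · rintro ⟨h, hs⟩ k hk
      have hk' := Finset.mem_range.1 hk
      simp only [hB', hk', dif_pos]
      split_ifs with hkn
      · refine ⟨h ⟨k, hk'⟩ trivial, ?_⟩
        rw [hkn, hlast]
        exact hs
      · exact h ⟨k, hk'⟩ trivial
  have hset : MeasurableSet {ω | ∀ k ∈ Finset.range (A.len m), z (A.τ (m - 1) + k + 1) ω ∈ B' k} := by
    have : {ω | ∀ k ∈ Finset.range (A.len m), z (A.τ (m - 1) + k + 1) ω ∈ B' k} =
        ⋂ k ∈ Finset.range (A.len m), z (A.τ (m - 1) + k + 1) ⁻¹' B' k := by ext; simp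
    rw [this]
    exact Finset.measurableSet_biInter _ fun k _ => hz.measurable_round (by omega) (hB'm k)
  have h2 : ∀ ω, G.indicator (fun _ => 1) ω *
      ∏ k ∈ Finset.range (A.len m), (B' k).indicator 1 (z (A.τ (m - 1) + k + 1) ω) =
      (G ∩ {ω | ∀ k ∈ Finset.range (A.len m), z (A.τ (m - 1) + k + 1) ω ∈ B' k}).indicator
        (1 : Ω → ENNReal) ω := fun ω => by
    by_cases hω : ∀ k ∈ Finset.range (A.len m), z (A.τ (m - 1) + k + 1) ω ∈ B' k
    · rw [Finset.prod_eq_one fun k hk => by rw [Set.indicator_of_mem (hω k hk)]; rfl, mul_one]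
      by_cases hg : ω ∈ G
      · rw [Set.indicator_of_mem hg, Set.indicator_of_mem (by simp only [Set.mem_inter_iff, Set.mem_ofPred_eq]; exact ⟨hg, hω⟩)]
        rfl
      · rw [Set.indicator_of_notMem hg, Set.indicator_of_notMem
          fun h => hg (Set.mem_of_mem_inter_left h)]
    · have hn : ω ∉ G ∩ {ω | ∀ k ∈ Finset.range (A.len m),
          z (A.τ (m - 1) + k + 1) ω ∈ B' k} := by
        simp only [Set.mem_inter_iff, Set.mem_ofPred_eq]
        exact fun h => hω h.2
      rw [Set.indicator_of_notMem hn]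
      push Not at hω
      obtain ⟨k, hk, hkω⟩ := hω
      rw [Finset.prod_eq_zero hk (Set.indicator_of_notMem hkω _), mul_zero]
  have h3 : ∀ ω, ∏ k ∈ Finset.range (A.len m),
      A.stepLaw E (A.kernel (fun s => z s ω) m) (B' k) =
      (∏ k, sampleLaw E (A.kernel (fun s => z s ω) m) (B k)) * A.seedLaw C := fun ω => by
    have hp := A.isActionKernel_kernel (fun s => z s ω) m
    have h4 : ∀ k : Fin (A.len m), A.stepLaw E (A.kernel (fun s => z s ω) m) (B' k) =
        sampleLaw E (A.kernel (fun s => z s ω) m) (B k) *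
          if k = (⟨n, by omega⟩ : Fin (A.len m)) then A.seedLaw C else 1 := fun k => by
      simp only [hB', k.2, dif_pos, Fin.ext_iff]
      split_ifs with hkn
      · exact A.stepLaw_sample_seed E hp (hB k) hC
      · rw [mul_one]; exact A.stepLaw_sample E hp (hB k)
    rw [Finset.prod_range, Finset.prod_congr rfl fun k _ => h4 k, Finset.prod_mul_distrib,
      Finset.prod_ite_eq' Finset.univ]
    simp
  simp only [hmem] at hset h2
  simp only [h2, h3, lintegral_indicator_one (hGm.inter hset)] at h1
  rw [h1, ← lintegral_indicator hGm]
  refine lintegral_congr fun ω => ?_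
  by_cases hg : ω ∈ G <;> simp [hg]

end IsRun

/-! ### Data and seed of an epoch -/

section EpochLaw

variable {Ω : Type*} {mΩ : MeasurableSpace Ω}

/-- Products of measurable boxes of data with measurable sets of seeds. -/
def dataBoxes (X S : Type*) [MeasurableSpace X] [MeasurableSpace S] (K n : ℕ) :
    Set (Set ((Fin n → X × Fin K × ℝ) × S)) :=
  Set.image2 (· ×ˢ ·)
    (Set.univ.pi '' Set.univ.pi fun _ : Fin n => {s : Set (X × Fin K × ℝ) | MeasurableSet s})
    {s : Set S | MeasurableSet s}

lemma isPiSystem_dataBoxes (X S : Type*) [MeasurableSpace X] [MeasurableSpace S] (K n : ℕ) :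
    IsPiSystem (dataBoxes X S K n) :=
  isPiSystem_pi.prod MeasurableSpace.isPiSystem_measurableSet

lemma generateFrom_dataBoxes (X S : Type*) [MeasurableSpace X] [MeasurableSpace S] (K n : ℕ) :
    (inferInstance : MeasurableSpace ((Fin n → X × Fin K × ℝ) × S)) =
      MeasurableSpace.generateFrom (dataBoxes X S K n) :=
  (generateFrom_eq_prod generateFrom_pi MeasurableSpace.generateFrom_measurableSet
    (IsCountablySpanning.pi fun _ => isCountablySpanning_measurableSet)
    isCountablySpanning_measurableSet).symm

lemma pi_sampleLaw_prod_box (E : Env X K) {p : X → Fin K → ℝ} (hp : IsActionKernel p) {n : ℕ}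
    (B : Fin n → Set (X × Fin K × ℝ)) (C : Set S) :
    ((Measure.pi fun _ : Fin n => sampleLaw E p).prod A.seedLaw) (Set.univ.pi B ×ˢ C) =
      (∏ k, sampleLaw E p (B k)) * A.seedLaw C := by
  have := isProbabilityMeasure_sampleLaw E hp
  rw [Measure.prod_prod, Measure.pi_pi]

variable (A) in
/-- The law of `n` samples and an independent seed, as a kernel of the parameter of `p`. -/
noncomputable def dataKernel (E : Env X K) (p : Ω → X → Fin K → ℝ)
    (hp : ∀ ω, IsActionKernel (p ω)) (hpm : ∀ a, Measurable fun q : Ω × X => p q.1 q.2 a)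
    (n : ℕ) : Kernel Ω ((Fin n → X × Fin K × ℝ) × S) where
  toFun ω := (Measure.pi fun _ : Fin n => sampleLaw E (p ω)).prod A.seedLaw
  measurable' := by
    have := fun ω => isProbabilityMeasure_sampleLaw E (hp ω)
    refine Measurable.measure_of_isPiSystem_of_isProbabilityMeasure
      (generateFrom_dataBoxes X S K n) (isPiSystem_dataBoxes X S K n) ?_
    rintro _ ⟨_, ⟨B, hB, rfl⟩, C, hC, rfl⟩
    simp only [fun ω => pi_sampleLaw_prod_box (A := A) E (hp ω) B C]
    refine (Finset.measurable_fun_prod _ fun k _ => ?_).mul_const _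
    have hBk : MeasurableSet (B k) := hB k trivial
    have hms : MeasurableSet {y : Round X S K | (y.1, y.2.2.1, y.2.1 y.2.2.1) ∈ B k} :=
      measurable_sample hBk
    simp only [← fun ω => A.stepLaw_sample E (hp ω) hBk, ← lintegral_indicator_one hms]
    exact measurable_lintegral_stepLaw E hp hpm (measurable_one.indicator hms)

lemma isMarkovKernel_dataKernel (E : Env X K) (p : Ω → X → Fin K → ℝ)
    (hp : ∀ ω, IsActionKernel (p ω)) (hpm : ∀ a, Measurable fun q : Ω × X => p q.1 q.2 a)
    (n : ℕ) : IsMarkovKernel (A.dataKernel E p hp hpm n) := by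
  refine ⟨fun ω => ?_⟩
  have := isProbabilityMeasure_sampleLaw E (hp ω)
  change IsProbabilityMeasure ((Measure.pi fun _ : Fin n => sampleLaw E (p ω)).prod A.seedLaw)
  infer_instance

/-- Conditionally on the earlier epochs, data and seed of epoch `m` are i.i.d. samples from
`D(p_m)` and an independent seed. -/
lemma IsRun.measure_data_seed_mem {E : Env X K} {P : Measure Ω} [IsFiniteMeasure P]
    {ℱ : Filtration ℕ mΩ} {z : ℕ → Ω → Round X S K} (hz : A.IsRun E P ℱ z) {m : ℕ}
    (hm : 1 ≤ m) {U : Set (Ω × (Fin (A.len m) → X × Fin K × ℝ) × S)}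
    (hU : MeasurableSet[(ℱ (A.τ (m - 1))).prod inferInstance] U) :
    P {ω | (ω, A.data (fun s => z s ω) m, A.seed (fun s => z s ω) m) ∈ U} =
      ∫⁻ ω, ((Measure.pi fun _ : Fin (A.len m) =>
        sampleLaw E (A.kernel (fun s => z s ω) m)).prod A.seedLaw) (Prod.mk ω ⁻¹' U) ∂P := by
  have hp := fun ω => A.isActionKernel_kernel (fun s => z s ω) m
  have hpm := A.measurable_kernel (mΩ := ℱ (A.τ (m - 1))) (z := z) (m := m)
    fun _ h1 h2 => hz.measurable_of_le h1 h2
  have := isMarkovKernel_dataKernel (mΩ := ℱ (A.τ (m - 1))) (A := A) E _ hp hpm (A.len m)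
  -- Here `θ` is the identity into `Ω` with the coarser σ-algebra of the past. The event `U` may
  -- thus depend on the past, and in particular on the random kernel itself.
  refine measure_prodMk_mem_eq_lintegral (mΘ := ℱ (A.τ (m - 1))) (θ := fun ω => ω)
    (measurable_id'' (ℱ.le _))
    ((A.measurable_data fun _ h1 _ => hz.measurable_round h1).prodMk
      (A.measurable_seed hm fun _ h1 _ => hz.measurable_round h1))
    (dataKernel (mΩ := ℱ (A.τ (m - 1))) A E _ hp hpm (A.len m))
    (generateFrom_dataBoxes X S K _) (isPiSystem_dataBoxes X S K _) ?_ hU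
  rintro G hG _ ⟨_, ⟨B, hB, rfl⟩, C, hC, rfl⟩
  refine (hz.measure_inter_data_seed hm hG (fun k => hB k trivial) hC).trans ?_
  exact lintegral_congr fun ω => (pi_sampleLaw_prod_box (A := A) E (hp ω) B C).symm

end EpochLaw

end Inputs

end ContextualBandit

namespace MeasureTheory

lemma measure_le_ofReal_of_compl {Ω : Type*} {mΩ : MeasurableSpace Ω} {μ : Measure Ω}
    [IsProbabilityMeasure μ] {U V : Set Ω} {ζ : ℝ} (hζ : ζ ≤ 1)
    (hV : ENNReal.ofReal (1 - ζ) ≤ μ V) (hVm : MeasurableSet V) (h : U ⊆ Vᶜ) :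
    μ U ≤ ENNReal.ofReal ζ := by
  refine (measure_mono h).trans ?_
  rw [prob_compl_eq_one_sub hVm]
  refine (tsub_le_tsub_left hV 1).trans (le_of_eq ?_)
  rw [← ENNReal.ofReal_one, ← ENNReal.ofReal_sub _ (by linarith)]
  congr 1
  ring

end MeasureTheory

namespace ContextualBandit

namespace Inputs

variable {X S : Type*} [MeasurableSpace X] [MeasurableSpace S] {K : ℕ} {A : Inputs X S K}

/-! ### Estimation and testing -/

lemma conf_pos (hM : 1 ≤ A.M) {m : ℕ} (hm : 1 ≤ m) : 0 < A.conf m := by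
  have h1 : (1 : ℝ) ≤ A.M := by exact_mod_cast hM
  have h2 : (1 : ℝ) ≤ m := by exact_mod_cast hm
  have := A.δ_pos
  unfold conf
  positivity

lemma M_mul_conf (hM : 1 ≤ A.M) (m : ℕ) : A.M * A.conf m = A.δ / (4 * m ^ 2) := by
  have h1 : (A.M : ℝ) ≠ 0 := by positivity
  unfold conf
  rw [show (4 : ℝ) * A.M * m ^ 2 = A.M * (4 * m ^ 2) by ring, ← div_div, mul_div_assoc']
  field_simp

lemma δ_div_le {m : ℕ} (hm : 1 ≤ m) : A.δ / (4 * (m : ℝ) ^ 2) ≤ 1 / 4 := by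
  have h2 : (1 : ℝ) ≤ m := by exact_mod_cast hm
  have h3 : (1 : ℝ) ≤ (m : ℝ) ^ 2 := one_le_pow₀ h2
  rw [div_le_div_iff₀ (by positivity) (by norm_num)]
  linarith [A.δ_lt_one]

lemma conf_le (hM : 1 ≤ A.M) {m : ℕ} (hm : 1 ≤ m) : A.conf m ≤ 1 / 4 := by
  have h1 : (1 : ℝ) ≤ A.M := by exact_mod_cast hM
  have h2 := A.δ_div_le hm
  rw [← M_mul_conf hM] at h2
  nlinarith [A.conf_pos hM hm]

lemma measurable_sqError_est {Ω : Type*} {mΩ : MeasurableSpace Ω} (E : Env X K)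
    {p : Ω → X → Fin K → ℝ} (hpm : ∀ a, Measurable fun q : Ω × X => p q.1 q.2 a) (i n : ℕ) :
    Measurable fun q : Ω × (Fin n → X × Fin K × ℝ) × S =>
      sqError E (p q.1) (A.est i n q.2.1 q.2.2) := by
  have h : Measurable fun q : (Ω × (Fin n → X × Fin K × ℝ) × S) × X =>
      ∑ a, p q.1.1 q.2 a * (A.est i n q.1.2.1 q.1.2.2 q.2 a - E.fstar q.2 a) ^ 2 := by
    refine Finset.measurable_fun_sum _ fun a _ => ?_
    have h1 : Measurable fun q : (Ω × (Fin n → X × Fin K × ℝ) × S) × X => (q.1.1, q.2) := by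
      fun_prop
    have h2 : Measurable fun q : (Ω × (Fin n → X × Fin K × ℝ) × S) × X => (q.1.2, q.2) := by
      fun_prop
    exact ((hpm a).comp h1).mul ((((A.est_measurable i n a).comp h2).sub
      ((E.fstar_measurable a).comp measurable_snd)).pow_const 2)
  exact (h.stronglyMeasurable.integral_prod_right' (ν := E.D.fst)).measurable

section Events

variable {Ω : Type*} {mΩ : MeasurableSpace Ω} {E : Env X K} {P : Measure Ω}
  [IsProbabilityMeasure P] {ℱ : Filtration ℕ mΩ} {z : ℕ → Ω → Round X S K}
  {F : ℕ → Set (X → Fin K → ℝ)} {C₀ : ℝ}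

lemma IsRun.measure_est_fails (hz : A.IsRun E P ℱ z) (hC₀ : 1 ≤ C₀)
    (hF : ∀ i ∈ Finset.Icc 1 A.M, ∀ f ∈ F i, IsModel f) (hest : A.EstOracleAssumption E F C₀)
    (hM : 1 ≤ A.M) {m : ℕ} (hm : 1 ≤ m) :
    P {ω | ¬ ∀ j ∈ Finset.Icc 1 A.M,
      sqError E (A.kernel (fun s => z s ω) m) (A.fhat (fun s => z s ω) (m + 1)) ≤
        C₀ * worstMisspec E (F j) + A.ξ j (A.len m) (A.conf m)} ≤
      ENNReal.ofReal (A.δ / (4 * m ^ 2)) := by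
  obtain ⟨n, rfl⟩ := Nat.exists_eq_add_of_le' hm
  have hp := fun ω => A.isActionKernel_kernel (fun s => z s ω) (n + 1)
  have hpm := A.measurable_kernel (mΩ := ℱ (A.τ (n + 1 - 1))) (z := z) (m := n + 1)
    fun _ h1 h2 => hz.measurable_of_le h1 h2
  have hem := measurable_sqError_est (mΩ := ℱ (A.τ (n + 1 - 1))) (A := A) E
    (p := fun ω => A.kernel (fun s => z s ω) (n + 1)) hpm A.M (A.len (n + 1))
  set V : Set (Ω × (Fin (A.len (n + 1)) → X × Fin K × ℝ) × S) := {q | ∀ j ∈ Finset.Icc 1 A.M,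
    sqError E (A.kernel (fun s => z s q.1) (n + 1)) (A.est A.M (A.len (n + 1)) q.2.1 q.2.2) ≤
        C₀ * worstMisspec E (F j) + A.ξ j (A.len (n + 1)) (A.conf (n + 1))} with hV
  have hVm : MeasurableSet[(ℱ (A.τ (n + 1 - 1))).prod inferInstance] V := by
    have h2 : V = ⋂ j ∈ Finset.Icc 1 A.M, {q | sqError E (A.kernel (fun s => z s q.1) (n + 1))
        (A.est A.M (A.len (n + 1)) q.2.1 q.2.2) ≤
          C₀ * worstMisspec E (F j) + A.ξ j (A.len (n + 1)) (A.conf (n + 1))} := by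
      ext q; simp [hV]
    rw [h2]
    exact Finset.measurableSet_biInter _ fun j _ => hem measurableSet_Iic
  have hlaw := hz.measure_data_seed_mem hm hVm.compl
  refine hlaw.le.trans ?_
  have hbound : ∀ ω, ((Measure.pi fun _ : Fin (A.len (n + 1)) =>
        sampleLaw E (A.kernel (fun s => z s ω) (n + 1))).prod A.seedLaw) (Prod.mk ω ⁻¹' Vᶜ) ≤
      ENNReal.ofReal (A.δ / (4 * ((n + 1 : ℕ) : ℝ) ^ 2)) := fun ω => by
    have := isProbabilityMeasure_sampleLaw E (hp ω)
    have hδ := A.δ_div_le hm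
    have hpos : 0 < A.δ / (4 * ((n + 1 : ℕ) : ℝ) ^ 2) := by have := A.δ_pos; positivity
    -- The level is `M * conf m`, so that the `ζ / M` in the oracle guarantee equals `conf m`.
    have h1 := hest A.M (Finset.mem_Icc.2 ⟨hM, le_rfl⟩) _ (hp ω) _ (A.two_le_len hm) _ hpos
      (hδ.trans (by norm_num))
    have hsec : MeasurableSet (Prod.mk ω ⁻¹' V) :=
      (@measurable_prodMk_left _ _ (ℱ (A.τ (n + 1 - 1))) _ ω) hVm
    refine measure_le_ofReal_of_compl (V := Prod.mk ω ⁻¹' V) (hδ.trans (by norm_num))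
      (h1.trans (measure_mono fun q hq => ?_)) hsec subset_rfl
    intro j hj
    refine (hq j hj).trans (add_le_add (mul_le_mul_of_nonneg_left
      (misspec_le_worstMisspec E (hF j hj) (hp ω)) (by linarith)) (le_of_eq ?_))
    rw [← M_mul_conf hM, mul_div_cancel_left₀ _ (by positivity)]
  refine (lintegral_mono hbound).trans ?_
  simp

/-- Since `β' i * τ_{m*_i} < β i` (or `β i = ⊤`), at most one of the two requirements is active in
an epoch, and a single failure probability `conf m` pays for both. -/
lemma IsRun.measure_test_fails (hz : A.IsRun E P ℱ z) {β : ℕ → ENNReal} {β' : ℕ → ℝ}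
    (htest : A.TestAssumption E F C₀ P z β β') (hM : 1 ≤ A.M) {i : ℕ}
    (hi : i ∈ Finset.Icc 1 A.M) {m : ℕ} (hm : 1 ≤ m) :
    P {ω | ¬ (((A.τ m : ENNReal) ≤ ENNReal.ofReal (β' i) * A.safeTime E F C₀ i →
        A.test (fun s => z s ω) i m (A.conf m) = false) ∧
      (β i < (A.τ m : ENNReal) → A.test (fun s => z s ω) i m (A.conf m) = true))} ≤
      ENNReal.ofReal (A.conf m) := by
  have hc : A.conf m ∈ Set.Ioo (0 : ℝ) 1 :=
    ⟨A.conf_pos hM hm, (A.conf_le hM hm).trans_lt (by norm_num)⟩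
  have hmt := A.measurable_test (z := z) hm i (A.conf m) fun t h1 _ => hz.measurable_round h1
  by_cases h1 : (A.τ m : ENNReal) ≤ ENNReal.ofReal (β' i) * A.safeTime E F C₀ i
  · have h2 : ¬ β i < (A.τ m : ENNReal) := fun h => by
      rcases htest.β'_lt i hi with h3 | h3
      · exact absurd (h1.trans_lt h3) (not_lt.2 h.le)
      · rw [h3] at h; exact not_top_lt h
    refine measure_le_ofReal_of_compl hc.2.le (htest.accept i hi m hm _ hc h1)
      (hmt (measurableSet_singleton false)) fun ω hω hω' => hω ?_
    exact ⟨fun _ => hω', fun h => absurd h h2⟩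
  · by_cases h2 : β i < (A.τ m : ENNReal)
    · refine measure_le_ofReal_of_compl hc.2.le (htest.reject i hi m hm _ hc h2)
        (hmt (measurableSet_singleton true)) fun ω hω hω' => hω ?_
      exact ⟨fun h => absurd h h1, fun _ => hω'⟩
    · simp [h1, h2]

end Events

/-! ### Concentration of the regret -/

lemma regret_mem (A : Inputs X S K) (E : Env X K) (x : X) (a : Fin K) :
    E.regret x a ∈ Set.Icc (0 : ℝ) 1 := by
  rw [A.regret_eq_gap]
  exact ⟨A.gap_nonneg _ x a, A.gap_le_one E.isModel_fstar x a⟩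

lemma measurable_regret (A : Inputs X S K) (E : Env X K) :
    Measurable fun y : Round X S K => E.regret y.1 y.2.2.1 := by
  have h : Measurable fun q : X × Fin K => E.regret q.1 q.2 :=
    measurable_from_prod_countable_left fun a => by
      simpa only [A.regret_eq_gap] using A.measurable_gap E.isModel_fstar a
  exact h.comp (f := fun y : Round X S K => (y.1, y.2.2.1)) (by fun_prop)

lemma integral_regret_stepLaw (E : Env X K) {p : X → Fin K → ℝ} (hp : IsActionKernel p) :
    ∫ y, E.regret y.1 y.2.2.1 ∂A.stepLaw E p = ∫ x, ∑ a, p x a * E.regret x a ∂E.D.fst := by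
  have hr := A.regret_mem E
  have hm : ∀ a, Measurable fun x => E.regret x a := fun a => by
    simpa only [A.regret_eq_gap] using A.measurable_gap E.isModel_fstar a
  have hs : Measurable fun x => ∑ a, p x a * E.regret x a :=
    Finset.measurable_fun_sum _ fun a _ => (hp.1 a).mul (hm a)
  rw [integral_eq_lintegral_of_nonneg_ae (.of_forall fun y => (hr _ _).1)
      (A.measurable_regret E).aestronglyMeasurable,
    integral_eq_lintegral_of_nonneg_ae
      (.of_forall fun x => hp.sum_mul_nonneg x fun a => (hr x a).1) hs.aestronglyMeasurable]
  congr 1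
  refine (lintegral_stepLaw E hp
    (ENNReal.measurable_ofReal.comp (A.measurable_regret E))).trans ?_
  simp only [Function.comp]
  -- Both sides are brought to integrals over environment and seed; the context marginal ignores the
  -- seed.
  have h1 : E.D.fst = (E.D.prod A.seedLaw).map fun q => q.1.1 := by
    have : E.D = (E.D.prod A.seedLaw).map Prod.fst := by
      rw [← Measure.fst, Measure.fst_prod]
    conv_lhs => rw [this]
    rw [Measure.fst, Measure.map_map measurable_fst measurable_fst]
    rfl
  rw [h1, lintegral_map hs.ennreal_ofReal (by fun_prop),
    ← lintegral_finsetSum]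
  · refine lintegral_congr fun q => ?_
    rw [ENNReal.ofReal_sum_of_nonneg fun a _ => mul_nonneg (hp.2.1 _ a) (hr _ a).1]
    simp only [ENNReal.ofReal_mul (hp.2.1 _ _)]
  · intro a _
    exact (ENNReal.measurable_ofReal.comp ((hp.1 a).comp (by fun_prop))).mul
      (ENNReal.measurable_ofReal.comp ((hm a).comp (by fun_prop)))

lemma lintegral_exp_regret_stepLaw (E : Env X K) {p : X → Fin K → ℝ} (hp : IsActionKernel p)
    (l : ℝ) : ∫⁻ y, ENNReal.ofReal (Real.exp (l * E.regret y.1 y.2.2.1)) ∂A.stepLaw E p ≤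
      ENNReal.ofReal (Real.exp (l * ∫ x, ∑ a, p x a * E.regret x a ∂E.D.fst + l ^ 2 / 8)) := by
  have := isProbabilityMeasure_stepLaw (A := A) E hp
  have hr := A.regret_mem E
  have hm := A.measurable_regret E
  -- Hoeffding's lemma on an interval of length one: variance proxy `1 / 4`, hence the exponent `l ^
  -- 2 / 8`.
  have hsub := hasSubgaussianMGF_of_mem_Icc (μ := A.stepLaw E p) hm.aemeasurable
    (.of_forall fun y => hr y.1 y.2.2.1)
  rw [integral_regret_stepLaw E hp] at hsub
  set c := ∫ x, ∑ a, p x a * E.regret x a ∂E.D.fst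
  have h1 := hsub.mgf_le l
  have h2 := hsub.integrable_exp_mul l
  have h3 : ∀ y : Round X S K, ENNReal.ofReal (Real.exp (l * E.regret y.1 y.2.2.1)) =
      ENNReal.ofReal (Real.exp (l * c)) *
        ENNReal.ofReal (Real.exp (l * (E.regret y.1 y.2.2.1 - c))) := fun y => by
    rw [← ENNReal.ofReal_mul (Real.exp_pos _).le, ← Real.exp_add]
    ring_nf
  rw [lintegral_congr h3, lintegral_const_mul' _ _ ENNReal.ofReal_ne_top,
    ← ofReal_integral_eq_lintegral_ofReal h2 (.of_forall fun _ => (Real.exp_pos _).le),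
    ← ENNReal.ofReal_mul (Real.exp_pos _).le]
  refine ENNReal.ofReal_le_ofReal ?_
  rw [Real.exp_add]
  refine mul_le_mul_of_nonneg_left (h1.trans (le_of_eq ?_)) (Real.exp_pos _).le
  norm_num
  ring

section Concentration

variable {Ω : Type*} {mΩ : MeasurableSpace Ω} {E : Env X K} {P : Measure Ω}
  {ℱ : Filtration ℕ mΩ} {z : ℕ → Ω → Round X S K}

lemma measurable_integral_regret (A : Inputs X S K) {Ω : Type*} {mΩ : MeasurableSpace Ω}
    (E : Env X K) {p : Ω → X → Fin K → ℝ}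
    (hpm : ∀ a, Measurable fun q : Ω × X => p q.1 q.2 a) :
    Measurable fun ω => ∫ x, ∑ a, p ω x a * E.regret x a ∂E.D.fst := by
  have h : Measurable fun q : Ω × X => ∑ a, p q.1 q.2 a * E.regret q.2 a := by
    refine Finset.measurable_fun_sum _ fun a _ => (hpm a).mul ?_
    have : Measurable fun x => E.regret x a := by
      simpa only [A.regret_eq_gap] using A.measurable_gap E.isModel_fstar a
    exact this.comp measurable_snd
  exact (h.stronglyMeasurable.integral_prod_right' (ν := E.D.fst)).measurable

namespace IsRun

lemma measurable_condRegret (hz : A.IsRun E P ℱ z) {s : ℕ} (hs : 1 ≤ s) {t : ℕ}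
    (hst : s ≤ t + 1) : Measurable[ℱ t] fun ω =>
      ∫ x, ∑ a, A.kernel (fun s => z s ω) (A.epoch s) x a * E.regret x a ∂E.D.fst := by
  refine A.measurable_integral_regret (mΩ := ℱ t) E
    (A.measurable_kernel (mΩ := ℱ t) fun r h1 h2 => hz.measurable_of_le h1 ?_)
  have := A.τ_pred_epoch_lt hs
  omega

lemma measurable_cumRegret_sub (hz : A.IsRun E P ℱ z) (t : ℕ) : Measurable[ℱ t] fun ω =>
    cumRegret E (fun s => z s ω) t - A.cumCondRegret E (fun s => z s ω) t := by
  refine Measurable.sub ?_ ?_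
  · refine Finset.measurable_fun_sum _ fun s hs => ?_
    rw [Finset.mem_Icc] at hs
    exact (A.measurable_regret E).comp (hz.measurable_of_le hs.1 hs.2)
  · refine Finset.measurable_fun_sum _ fun s hs => ?_
    rw [Finset.mem_Icc] at hs
    exact hz.measurable_condRegret hs.1 (by omega)

/-- The conditional regret `c` of round `t + 1` is known at time `t`. Conditioning there leaves one
centred moment generating function, and each round multiplies the bound by `exp (l ^ 2 / 8)`. -/
lemma lintegral_exp_cumRegret_sub [IsProbabilityMeasure P] (hz : A.IsRun E P ℱ z) (l : ℝ)
    (t : ℕ) : ∫⁻ ω, ENNReal.ofReal (Real.exp (l * (cumRegret E (fun s => z s ω) t -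
      A.cumCondRegret E (fun s => z s ω) t))) ∂P ≤ ENNReal.ofReal (Real.exp (t * (l ^ 2 / 8))) := by
  induction t with
  | zero => simp [cumRegret, cumCondRegret]
  | succ t ih =>
    set c : Ω → ℝ := fun ω => ∫ x, ∑ a, A.kernel (fun s => z s ω) (A.epoch (t + 1)) x a *
      E.regret x a ∂E.D.fst with hc
    set D : Ω → ℝ := fun ω => cumRegret E (fun s => z s ω) t -
      A.cumCondRegret E (fun s => z s ω) t with hD
    have hcm : Measurable[ℱ t] c := hz.measurable_condRegret (Nat.le_add_left 1 t) le_rfl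
    have hDm : Measurable[ℱ t] D := hz.measurable_cumRegret_sub t
    have h1 : ∀ ω, ENNReal.ofReal (Real.exp (l * (cumRegret E (fun s => z s ω) (t + 1) -
        A.cumCondRegret E (fun s => z s ω) (t + 1)))) =
        ENNReal.ofReal (Real.exp (l * (D ω - c ω))) *
          ENNReal.ofReal (Real.exp (l * E.regret (z (t + 1) ω).1 (z (t + 1) ω).2.2.1)) :=
      fun ω => by
        rw [← ENNReal.ofReal_mul (Real.exp_pos _).le, ← Real.exp_add]
        simp only [cumRegret, cumCondRegret, Finset.sum_Icc_succ_top (Nat.le_add_left 1 t), hD, hc]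
        ring_nf
    have hh : Measurable[ℱ t] fun ω => ENNReal.ofReal (Real.exp (l * (D ω - c ω))) :=
      ENNReal.measurable_ofReal.comp (Real.measurable_exp.comp ((hDm.sub hcm).const_mul l))
    rw [lintegral_congr h1]
    refine (hz.lintegral_mul t hh (ENNReal.measurable_ofReal.comp
      (Real.measurable_exp.comp ((A.measurable_regret E).const_mul l)))).le.trans ?_
    calc _ ≤ ∫⁻ ω, ENNReal.ofReal (Real.exp (l * (D ω - c ω))) *
          ENNReal.ofReal (Real.exp (l * c ω + l ^ 2 / 8)) ∂P :=
          lintegral_mono fun ω => mul_le_mul_right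
            (lintegral_exp_regret_stepLaw E (A.isActionKernel_kernel _ _) l) _
      _ = ∫⁻ ω, ENNReal.ofReal (Real.exp (l ^ 2 / 8)) *
          ENNReal.ofReal (Real.exp (l * D ω)) ∂P := lintegral_congr fun ω => by
          rw [← ENNReal.ofReal_mul (Real.exp_pos _).le, ← Real.exp_add,
            ← ENNReal.ofReal_mul (Real.exp_pos _).le, ← Real.exp_add]
          ring_nf
      _ ≤ ENNReal.ofReal (Real.exp (l ^ 2 / 8)) *
          ENNReal.ofReal (Real.exp (t * (l ^ 2 / 8))) := by
          rw [lintegral_const_mul' _ _ ENNReal.ofReal_ne_top]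
          exact mul_le_mul_right ih _
      _ = _ := by
          rw [← ENNReal.ofReal_mul (Real.exp_pos _).le, ← Real.exp_add]
          push_cast
          ring_nf

/-- Azuma–Hoeffding bound for the regret around its conditional version. -/
lemma measure_cumRegret_fails [IsProbabilityMeasure P] (hz : A.IsRun E P ℱ z) {t : ℕ}
    (ht : 1 ≤ t) : P {ω | ¬ cumRegret E (fun s => z s ω) t ≤
      A.cumCondRegret E (fun s => z s ω) t + √(t * Real.log (12 * t ^ 2 / A.δ))} ≤
      ENNReal.ofReal (A.δ / (12 * t ^ 2)) := by
  have ht' : (1 : ℝ) ≤ t := by exact_mod_cast ht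
  have ht2 : (1 : ℝ) ≤ (t : ℝ) ^ 2 := one_le_pow₀ ht'
  have hδ := A.δ_pos
  have hδ1 := A.δ_lt_one
  set L := Real.log (12 * t ^ 2 / A.δ) with hL
  have hL0 : 0 ≤ L := Real.log_nonneg (by rw [le_div_iff₀ hδ]; linarith)
  set x := √(t * L) with hx
  have hx2 : x ^ 2 = t * L := Real.sq_sqrt (by positivity)
  -- This `l` minimises `t * l ^ 2 / 8 - l * x`, with value `-2 * x ^ 2 / t = -2 * L`; `-L` is
  -- already enough.
  set l := 4 * x / t with hl
  have hl0 : 0 ≤ l := by positivity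
  have h1 := hz.lintegral_exp_cumRegret_sub l t
  have hDm := (hz.measurable_cumRegret_sub t).mono (ℱ.le t) le_rfl
  have h2 := mul_meas_ge_le_lintegral (μ := P)
    (ENNReal.measurable_ofReal.comp (Real.measurable_exp.comp (hDm.const_mul l)))
    (ENNReal.ofReal (Real.exp (l * x)))
  have h3 := h2.trans h1
  have h4 : P {ω | ¬ cumRegret E (fun s => z s ω) t ≤
      A.cumCondRegret E (fun s => z s ω) t + x} ≤
      P {ω | ENNReal.ofReal (Real.exp (l * x)) ≤ ENNReal.ofReal (Real.exp (l *
        (cumRegret E (fun s => z s ω) t - A.cumCondRegret E (fun s => z s ω) t)))} := by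
    refine measure_mono fun ω hω => ?_
    simp only [Set.mem_ofPred_eq, not_le] at hω ⊢
    exact ENNReal.ofReal_le_ofReal (Real.exp_le_exp.2
      (mul_le_mul_of_nonneg_left (by linarith) hl0))
  have hpos : ENNReal.ofReal (Real.exp (l * x)) ≠ 0 := by
    simpa using Real.exp_pos (l * x)
  have h5 := (ENNReal.le_div_iff_mul_le (Or.inl hpos) (Or.inl ENNReal.ofReal_ne_top)).2
    ((mul_comm _ _).le.trans ((mul_le_mul_right h4 _).trans h3))
  refine h5.trans ?_
  rw [← ENNReal.ofReal_div_of_pos (Real.exp_pos _), ← Real.exp_sub]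
  refine ENNReal.ofReal_le_ofReal ?_
  have h6 : t * (l ^ 2 / 8) - l * x = -2 * L := by
    rw [hl]
    field_simp
    rw [hx2]
    ring
  rw [h6]
  calc Real.exp (-2 * L) ≤ Real.exp (-L) := Real.exp_le_exp.2 (by linarith)
    _ = A.δ / (12 * t ^ 2) := by
      rw [Real.exp_neg, hL, Real.exp_log (by positivity), inv_div]

end IsRun

end Concentration

/-! ### The good event -/

/-- The properties of a history on which the regret bound rests. -/
structure GoodHistory (A : Inputs X S K) (E : Env X K) (F : ℕ → Set (X → Fin K → ℝ)) (C₀ : ℝ)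
    (β : ℕ → ENNReal) (β' : ℕ → ℝ) (h : ℕ → Round X S K) : Prop where
  est : ∀ m, 1 ≤ m → ∀ j ∈ Finset.Icc 1 A.M, sqError E (A.kernel h m) (A.fhat h (m + 1)) ≤
    C₀ * worstMisspec E (F j) + A.ξ j (A.len m) (A.conf m)
  accept : ∀ i ∈ Finset.Icc 1 A.M, ∀ m, 1 ≤ m →
    (A.τ m : ENNReal) ≤ ENNReal.ofReal (β' i) * A.safeTime E F C₀ i →
      A.test h i m (A.conf m) = false
  reject : ∀ i ∈ Finset.Icc 1 A.M, ∀ m, 1 ≤ m → β i < (A.τ m : ENNReal) →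
      A.test h i m (A.conf m) = true
  concentration : ∀ t, 1 ≤ t → cumRegret E h t ≤
    A.cumCondRegret E h t + √(t * Real.log (12 * t ^ 2 / A.δ))

/-- The failure budget at index `n` is `(1/4 + 1/4 + 1/12) δ / n ^ 2 = (7/12) δ / n ^ 2`, and `π ^ 2
/ 6 ≤ 12 / 7` keeps the total below `δ`. -/
lemma tsum_one_div_succ_sq_le : ∑' n : ℕ, 1 / ((n + 1 : ℕ) : ℝ) ^ 2 ≤ 12 / 7 := by
  have h := hasSum_zeta_two
  have h1 := (hasSum_nat_add_iff' 1).2 h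
  rw [h1.tsum_eq]
  have := Real.pi_lt_d2
  have := Real.pi_pos
  norm_num
  nlinarith

/-- Union bound over all epochs for the estimates and the `M` tests, and over all rounds for the
concentration; the same `n` indexes epochs and rounds. -/
lemma IsRun.exists_good {Ω : Type*} {mΩ : MeasurableSpace Ω} {E : Env X K} {P : Measure Ω}
    [IsProbabilityMeasure P] {ℱ : Filtration ℕ mΩ} {z : ℕ → Ω → Round X S K}
    {F : ℕ → Set (X → Fin K → ℝ)} {C₀ : ℝ} {β : ℕ → ENNReal} {β' : ℕ → ℝ}
    (hz : A.IsRun E P ℱ z) (hC₀ : 1 ≤ C₀)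
    (hF : ∀ i ∈ Finset.Icc 1 A.M, ∀ f ∈ F i, IsModel f) (hest : A.EstOracleAssumption E F C₀)
    (htest : A.TestAssumption E F C₀ P z β β') (hM : 1 ≤ A.M) :
    ∃ G : Set Ω, MeasurableSet G ∧ ENNReal.ofReal (1 - A.δ) ≤ P G ∧
      ∀ ω ∈ G, A.GoodHistory E F C₀ β β' fun s => z s ω := by
  set U₁ : ℕ → Set Ω := fun n => {ω | ¬ ∀ j ∈ Finset.Icc 1 A.M,
      sqError E (A.kernel (fun s => z s ω) (n + 1)) (A.fhat (fun s => z s ω) (n + 1 + 1)) ≤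
        C₀ * worstMisspec E (F j) + A.ξ j (A.len (n + 1)) (A.conf (n + 1))} with hU₁
  set U₂ : ℕ → ℕ → Set Ω := fun n i => {ω | ¬ (((A.τ (n + 1) : ENNReal) ≤
      ENNReal.ofReal (β' i) * A.safeTime E F C₀ i →
        A.test (fun s => z s ω) i (n + 1) (A.conf (n + 1)) = false) ∧
      (β i < (A.τ (n + 1) : ENNReal) →
        A.test (fun s => z s ω) i (n + 1) (A.conf (n + 1)) = true))} with hU₂
  set U₃ : ℕ → Set Ω := fun n => {ω | ¬ cumRegret E (fun s => z s ω) (n + 1) ≤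
      A.cumCondRegret E (fun s => z s ω) (n + 1) +
        √((n + 1 : ℕ) * Real.log (12 * ((n + 1 : ℕ) : ℝ) ^ 2 / A.δ))} with hU₃
  set U : Set Ω := ⋃ n, (U₁ n ∪ (⋃ i ∈ Finset.Icc 1 A.M, U₂ n i)) ∪ U₃ n with hU
  have hδ := A.δ_pos
  have hn : ∀ n, P ((U₁ n ∪ (⋃ i ∈ Finset.Icc 1 A.M, U₂ n i)) ∪ U₃ n) ≤
      ENNReal.ofReal (A.δ * (7 / 12) * (1 / ((n + 1 : ℕ) : ℝ) ^ 2)) := fun n => by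
    have hn1 : 1 ≤ n + 1 := Nat.le_add_left 1 n
    have h1 : P (U₁ n) ≤ _ := hz.measure_est_fails hC₀ hF hest hM hn1
    have h2 : P (⋃ i ∈ Finset.Icc 1 A.M, U₂ n i) ≤
        ENNReal.ofReal (A.δ / (4 * ((n + 1 : ℕ) : ℝ) ^ 2)) := by
      refine (measure_biUnion_finset_le _ _).trans ((Finset.sum_le_sum fun i hi =>
        hz.measure_test_fails htest hM hi hn1).trans (le_of_eq ?_))
      rw [Finset.sum_const, Nat.card_Icc, Nat.add_sub_cancel, nsmul_eq_mul, ← M_mul_conf hM,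
        ENNReal.ofReal_mul (Nat.cast_nonneg _), ENNReal.ofReal_natCast]
    have h3 : P (U₃ n) ≤ _ := hz.measure_cumRegret_fails hn1
    refine (measure_union_le _ _).trans ((add_le_add ((measure_union_le _ _).trans
      (add_le_add h1 h2)) h3).trans (le_of_eq ?_))
    rw [← ENNReal.ofReal_add (by positivity) (by positivity),
      ← ENNReal.ofReal_add (by positivity) (by positivity)]
    congr 1
    field_simp
    norm_num
  have hPU : P U ≤ ENNReal.ofReal A.δ := by
    have hsum : Summable fun n : ℕ => A.δ * (7 / 12) * (1 / ((n + 1 : ℕ) : ℝ) ^ 2) :=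
      (((summable_nat_add_iff 1).2 hasSum_zeta_two.summable)).mul_left _
    refine (measure_iUnion_le _).trans ((ENNReal.tsum_le_tsum hn).trans ?_)
    rw [← ENNReal.ofReal_tsum_of_nonneg (fun n => by positivity) hsum, tsum_mul_left]
    refine ENNReal.ofReal_le_ofReal ?_
    nlinarith [tsum_one_div_succ_sq_le]
  -- A measurable hull of the bad event has the same probability, so measurability of `U` itself is
  -- not needed.
  refine ⟨(toMeasurable P U)ᶜ, (measurableSet_toMeasurable P U).compl, ?_, fun ω hω => ?_⟩
  · rw [prob_compl_eq_one_sub (measurableSet_toMeasurable P U), measure_toMeasurable,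
      ENNReal.ofReal_sub _ hδ.le, ENNReal.ofReal_one]
    exact tsub_le_tsub_left hPU 1
  · have hωU : ω ∉ U := fun h => hω (subset_toMeasurable P U h)
    simp only [hU, hU₁, hU₂, hU₃, Set.mem_iUnion, Set.mem_union, Set.mem_ofPred_eq, not_exists, not_or,
      not_not] at hωU
    have hsucc : ∀ m, 1 ≤ m → ∃ n, m = n + 1 := fun m hm => ⟨m - 1, by omega⟩
    refine ⟨fun m hm => ?_, fun i hi m hm => ?_, fun i hi m hm => ?_, fun m hm => ?_⟩ <;>
      obtain ⟨n, rfl⟩ := hsucc m hm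
    · exact (hωU n).1.1
    · exact ((hωU n).1.2 i hi).1
    · exact ((hωU n).1.2 i hi).2
    · exact (hωU n).2

end Inputs

end ContextualBandit

namespace ContextualBandit

/-! ### Elementary estimates -/

lemma log_three_ge : (1.09 : ℝ) ≤ Real.log 3 := by
  have h1 : Real.log 9 = 2 * Real.log 3 := by
    rw [show (9 : ℝ) = 3 ^ 2 by norm_num, Real.log_pow]; norm_num
  have h2 : Real.log 9 = 3 * Real.log 2 + Real.log (9 / 8) := by
    rw [show (9 : ℝ) = 2 ^ 3 * (9 / 8) by norm_num, Real.log_mul (by norm_num) (by norm_num),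
      Real.log_pow]
    norm_num
  have h3 := Real.one_sub_inv_le_log_of_pos (show (0 : ℝ) < 9 / 8 by norm_num)
  norm_num at h3
  linarith [Real.log_two_gt_d9]

lemma log_nat_ge {t : ℕ} (ht : 3 ≤ t) : (1.09 : ℝ) ≤ Real.log t :=
  log_three_ge.trans (Real.log_le_log (by norm_num) (by exact_mod_cast ht))

/-- Keeps `ln (M ln t / δ)` away from zero for `t ≥ 3`, so that additive constants can be absorbed
into it. -/
lemma log_ge_of_ge {y : ℝ} (hy : 1.09 ≤ y) : 0.08 ≤ Real.log y := by
  have h := Real.one_sub_inv_le_log_of_pos (show 0 < y by linarith)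
  have h1 : y⁻¹ ≤ (1.09 : ℝ)⁻¹ := inv_anti₀ (by norm_num) hy
  norm_num at h1
  linarith

/-- The ratio `(r + 1) ^ 2 / 2 ^ r` peaks at `r = 2` with value `9 / 4`; from there on the square
grows by less than a factor two. -/
lemma four_mul_succ_sq_le (r : ℕ) : 4 * (r + 1) ^ 2 ≤ 9 * 2 ^ r := by
  match r with
  | 0 => norm_num
  | 1 => norm_num
  | r + 2 =>
    induction r with
    | zero => norm_num
    | succ r ih =>
      have h : 2 ^ (r + 1 + 2) = 2 * 2 ^ (r + 2) := by ring
      rw [h]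
      generalize 2 ^ (r + 2) = p at ih
      have h1 : (r + 1 + 2 + 1) ^ 2 ≤ 2 * (r + 2 + 1) ^ 2 := by ring_nf; omega
      omega

/-- This sums the decaying burn-in error over rounds: about `T` rounds cost at most 1 each, and the
tail of `T ^ 2 / s ^ 2` adds another `T`. The induction carries the sharper value `2 * T - T ^ 2 /
t`, for which the tail telescopes. -/
lemma sum_min_one_sq_div_le {T : ℝ} (hT : 0 ≤ T) (t : ℕ) :
    ∑ s ∈ Finset.Icc 1 t, min 1 (T ^ 2 / (s : ℝ) ^ 2) ≤ 2 * T := by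
  have key : ∀ t : ℕ, ∑ s ∈ Finset.Icc 1 t, min 1 (T ^ 2 / (s : ℝ) ^ 2) ≤
      if (t : ℝ) ≤ T then (t : ℝ) else 2 * T - T ^ 2 / t := fun t => by
    induction t with
    | zero => simp [hT]
    | succ t ih =>
      rw [Finset.sum_Icc_succ_top (Nat.le_add_left 1 t)]
      have ht0 : (0 : ℝ) ≤ t := Nat.cast_nonneg t
      push_cast at ih ⊢
      split_ifs with h
      · rw [if_pos (by linarith)] at ih
        linarith [min_le_left 1 (T ^ 2 / ((t : ℝ) + 1) ^ 2)]
      · push Not at h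
        split_ifs at ih with h'
        -- The step across `T`, where `t ≤ T < t + 1`: with `u = T / (t + 1)` the slack factors as
        -- `(1 - u) * (u * (t + 2) - t)`.
        · have h2 := min_le_left 1 (T ^ 2 / ((t : ℝ) + 1) ^ 2)
          have h3 := min_le_right 1 (T ^ 2 / ((t : ℝ) + 1) ^ 2)
          set u := T / ((t : ℝ) + 1) with hu
          have hu1 : u ≤ 1 := (div_le_one (by positivity)).2 h.le
          have hu0 : 0 ≤ u := by positivity
          have h4 : T ^ 2 / ((t : ℝ) + 1) ^ 2 = u ^ 2 := by rw [hu, div_pow]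
          have h5 : T ^ 2 / ((t : ℝ) + 1) = T * u := by rw [hu]; ring
          have h6 : T = u * ((t : ℝ) + 1) := by rw [hu]; field_simp
          rw [h4] at h3
          rw [h5]
          rw [h4]
          have h7 : (t : ℝ) + u ^ 2 ≤ 2 * T - T * u := by
            have h8 : 0 ≤ (1 - u) * (u * (t + 2) - t) :=
              mul_nonneg (by linarith) (by nlinarith)
            have h9 : 2 * T - T * u - (t + u ^ 2) = (1 - u) * (u * (t + 2) - t) := by
              rw [h6]; ring
            linarith
          linarith
        · push Not at h'
          have h3 := min_le_right 1 (T ^ 2 / ((t : ℝ) + 1) ^ 2)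
          have htp : (0 : ℝ) < t := hT.trans_lt h'
          have h4 : T ^ 2 / ((t : ℝ) + 1) ^ 2 ≤ T ^ 2 / t - T ^ 2 / ((t : ℝ) + 1) := by
            rw [div_sub_div _ _ (by positivity) (by positivity),
              div_le_div_iff₀ (by positivity) (by positivity)]
            have : 0 ≤ T ^ 2 * (t + 1) := by positivity
            nlinarith
          linarith
  refine (key t).trans ?_
  split_ifs with h
  · linarith
  · have : 0 ≤ T ^ 2 / (t : ℝ) := by positivity
    linarith

lemma sum_one_div_sqrt_le (t : ℕ) : ∑ s ∈ Finset.Icc 1 t, 1 / √(s : ℝ) ≤ 2 * √t := by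
  induction t with
  | zero => simp
  | succ t ih =>
    rw [Finset.sum_Icc_succ_top (Nat.le_add_left 1 t)]
    have h1 : 0 < √((t + 1 : ℕ) : ℝ) := Real.sqrt_pos.2 (by positivity)
    have h2 := Real.sqrt_nonneg (t : ℝ)
    have h3 : √((t + 1 : ℕ) : ℝ) ^ 2 = t + 1 := by rw [Real.sq_sqrt (by positivity)]; push_cast; rfl
    have h4 : √(t : ℝ) ^ 2 = t := Real.sq_sqrt (by positivity)
    have h5 : 1 / √((t + 1 : ℕ) : ℝ) ≤ 2 * √((t + 1 : ℕ) : ℝ) - 2 * √t := by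
      rw [div_le_iff₀ h1]
      nlinarith [sq_nonneg (√((t + 1 : ℕ) : ℝ) - √t)]
    linarith

/-- The exploration parameter `√(κ/(8x))` tuned to a rate `x` in place of `y`. -/
lemma sqrt_div_tuning {κ x y w ρ : ℝ} (hκ : 0 < κ) (hx : 0 < x) (hxy : x ≤ y) (hyw : y ≤ w)
    (hρ : 0 ≤ ρ) (hyx : y ≤ ρ ^ 2 * x) :
    κ / √(κ / (8 * x)) ≤ 3 * √(κ * w) ∧ 30 * y * √(κ / (8 * x)) ≤ 11 * ρ * √(κ * w) := by
  have hg : 0 < κ / (8 * x) := by positivity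
  have hy : 0 < y := hx.trans_le hxy
  have hw : 0 < w := hy.trans_le hyw
  constructor
  · refine abs_le_of_sq_le_sq' ?_ (by positivity) |>.2
    rw [div_pow, Real.sq_sqrt hg.le, mul_pow, Real.sq_sqrt (by positivity)]
    have : κ ^ 2 / (κ / (8 * x)) = 8 * (κ * x) := by field_simp
    rw [this]
    nlinarith [mul_le_mul_of_nonneg_left (hxy.trans hyw) hκ.le, mul_pos hκ hw]
  · refine abs_le_of_sq_le_sq' ?_ (by positivity) |>.2
    rw [mul_pow (30 * y), Real.sq_sqrt hg.le, mul_pow (11 * ρ), Real.sq_sqrt (by positivity)]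
    have h1 : y * y / x ≤ ρ ^ 2 * w := by
      rw [div_le_iff₀ hx]
      nlinarith [mul_le_mul hyx hyw hy.le (by positivity : (0 : ℝ) ≤ ρ ^ 2 * x)]
    have h2 : (30 * y) ^ 2 * (κ / (8 * x)) = 900 / 8 * κ * (y * y / x) := by field_simp; ring
    rw [h2]
    have h3 : 0 ≤ ρ ^ 2 * w := by positivity
    calc 900 / 8 * κ * (y * y / x) ≤ 900 / 8 * κ * (ρ ^ 2 * w) := by gcongr
      _ ≤ (11 * ρ) ^ 2 * (κ * w) := by nlinarith [mul_nonneg hκ.le h3]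

namespace Inputs

variable {X S : Type*} [MeasurableSpace X] [MeasurableSpace S] {K : ℕ} {A : Inputs X S K}

lemma one_div_conf (m : ℕ) : 1 / A.conf m = 4 * A.M * m ^ 2 / A.δ := by
  unfold conf
  rw [one_div_div]

lemma four_le_one_div_conf (hM : 1 ≤ A.M) {m : ℕ} (hm : 1 ≤ m) : 4 ≤ 1 / A.conf m := by
  rw [le_div_iff₀ (conf_pos hM hm)]
  linarith [A.conf_le hM hm]

lemma one_le_M_log_div {t : ℕ} (hM : 1 ≤ A.M) (ht : 3 ≤ t) :
    1.09 ≤ A.M * Real.log t / A.δ ∧ 1 / A.δ ≤ A.M * Real.log t / A.δ := by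
  have hδ := A.δ_pos
  have hM' : (1 : ℝ) ≤ A.M := by exact_mod_cast hM
  have hl := log_nat_ge ht
  have h1 : 1.09 ≤ A.M * Real.log t := by nlinarith
  constructor
  · rw [le_div_iff₀ hδ]; nlinarith [A.δ_lt_one]
  · gcongr; linarith

/-- From `2 ^ m ≤ t` follows `m ≤ 2 ln t`, so `1 / conf m` is at most `16 * y ^ 2` with `y = M ln t
/ δ`; the constant `ln 16` is absorbed by `48 * ln y`. -/
lemma log_one_div_conf_le (hM : 1 ≤ A.M) {m t : ℕ} (ht : 3 ≤ t) (hm : 1 ≤ m)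
    (hmt : 2 ^ m ≤ t) :
    Real.log (1 / A.conf m) ≤ 50 * Real.log (A.M * Real.log t / A.δ) := by
  have hδ := A.δ_pos
  have hM' : (1 : ℝ) ≤ A.M := by exact_mod_cast hM
  have hm' : (1 : ℝ) ≤ m := by exact_mod_cast hm
  have hl := log_nat_ge ht
  obtain ⟨hy, hy'⟩ := A.one_le_M_log_div hM ht
  set l := Real.log t with hl_def
  set y := A.M * l / A.δ with hy_def
  have hg := log_ge_of_ge hy
  have h1 : m * Real.log 2 ≤ l := by
    rw [← Real.log_pow]
    exact Real.log_le_log (by positivity) (by exact_mod_cast hmt)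
  have h2 : (m : ℝ) ≤ 2 * l := by nlinarith [Real.log_two_gt_d9]
  have h3 : 1 / A.conf m ≤ 16 * y ^ 2 := by
    rw [one_div_conf, hy_def, div_pow, mul_div_assoc', div_le_div_iff₀ hδ (by positivity)]
    have h4 : (m : ℝ) ^ 2 ≤ (2 * l) ^ 2 := by gcongr
    have h5 : (A.M : ℝ) ≤ A.M ^ 2 := by nlinarith
    have h6 : A.δ ^ 2 ≤ A.δ := by nlinarith [A.δ_lt_one]
    calc 4 * A.M * (m : ℝ) ^ 2 * A.δ ^ 2 ≤ 4 * A.M ^ 2 * (2 * l) ^ 2 * A.δ := by gcongr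
      _ = 16 * (A.M * l) ^ 2 * A.δ := by ring
  have h4 : Real.log (1 / A.conf m) ≤ Real.log 16 + 2 * Real.log y := by
    refine (Real.log_le_log (by have := conf_pos hM hm; positivity) h3).trans (le_of_eq ?_)
    rw [Real.log_mul (by norm_num) (by positivity), Real.log_pow]
    norm_num
  have h5 : Real.log 16 = 4 * Real.log 2 := by
    rw [show (16 : ℝ) = 2 ^ 4 by norm_num, Real.log_pow]; norm_num
  linarith [Real.log_two_lt_d9]

lemma log_deviation_le (hM : 1 ≤ A.M) {t : ℕ} (ht : 3 ≤ t) :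
    Real.log (12 * t ^ 2 / A.δ) ≤
      60 * (Real.log t * Real.log (A.M * Real.log t / A.δ)) := by
  have hδ := A.δ_pos
  have hl := log_nat_ge ht
  obtain ⟨hy, hy'⟩ := A.one_le_M_log_div hM ht
  have ht0 : (0 : ℝ) < t := by positivity
  have h1 : Real.log (12 * t ^ 2 / A.δ) = Real.log 12 + 2 * Real.log t + Real.log (1 / A.δ) := by
    rw [show 12 * (t : ℝ) ^ 2 / A.δ = 12 * t ^ 2 * (1 / A.δ) by ring,
      Real.log_mul (by positivity) (by positivity), Real.log_mul (by norm_num) (by positivity),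
      Real.log_pow]
    norm_num
  have h2 : Real.log (1 / A.δ) ≤ Real.log (A.M * Real.log t / A.δ) :=
    Real.log_le_log (by positivity) hy'
  have h3 : Real.log 12 ≤ 4 * Real.log 2 := by
    rw [show 4 * Real.log 2 = Real.log 16 by
      rw [show (16 : ℝ) = 2 ^ 4 by norm_num, Real.log_pow]; norm_num]
    exact Real.log_le_log (by norm_num) (by norm_num)
  have hg := log_ge_of_ge hy
  set l := Real.log t
  set g := Real.log (A.M * l / A.δ)
  have e1 : l * 0.08 ≤ l * g := mul_le_mul_of_nonneg_left hg (by linarith)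
  have e2 : 1.09 * g ≤ l * g := mul_le_mul_of_nonneg_right hl (by linarith)
  linarith [Real.log_two_lt_d9]

/-! ### Rates along the epochs -/

/-- Lengths double from epoch 2 on, but epochs 1 and 2 are equally long; this accounts for the loss
of a factor two. -/
lemma len_add_le {m : ℕ} (hm : 1 ≤ m) (r : ℕ) :
    A.len (m + r) ≤ 2 ^ r * A.len m ∧ 2 ^ r * A.len m ≤ 2 * A.len (m + r) := by
  match m, hm, r with
  | 1, _, 0 => simp; omega
  | 1, _, r + 1 =>
    rw [show 1 + (r + 1) = r + 2 by ring, len_add_two, len_one, pow_succ]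
    constructor <;> nlinarith [Nat.zero_le (2 ^ r * A.τ₁)]
  | m + 2, _, r =>
    rw [show m + 2 + r = (m + r) + 2 by ring, len_add_two, len_add_two, pow_add]
    constructor <;> nlinarith [Nat.zero_le (2 ^ m * 2 ^ r * A.τ₁)]

variable (A) in
/-- The rate of class `i` at the end of epoch `m`. -/
noncomputable def rate (i m : ℕ) : ℝ := A.ξ i (A.len m) (A.conf m)

lemma rate_eq (i m : ℕ) : A.rate i m =
    A.C₁ * A.d i * (Real.log (A.len m) * Real.log (1 / A.conf m) / A.len m) := by
  unfold rate ξ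
  ring

lemma log_len_pos {m : ℕ} (hm : 1 ≤ m) : 0 < Real.log (A.len m) :=
  Real.log_pos (by exact_mod_cast A.two_le_len hm)

lemma log_one_div_conf_pos (hM : 1 ≤ A.M) {m : ℕ} (hm : 1 ≤ m) :
    0 < Real.log (1 / A.conf m) :=
  Real.log_pos (by linarith [A.four_le_one_div_conf hM hm])

lemma rate_factor_pos (hM : 1 ≤ A.M) {m : ℕ} (hm : 1 ≤ m) :
    0 < Real.log (A.len m) * Real.log (1 / A.conf m) / A.len m := by
  have h1 := A.log_len_pos hm
  have h2 := A.log_one_div_conf_pos hM hm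
  have h3 := A.two_le_len hm
  positivity

lemma rate_pos (hC₁ : 0 < A.C₁) (hM : 1 ≤ A.M) {i : ℕ} (hd : 1 ≤ A.d i) {m : ℕ} (hm : 1 ≤ m) :
    0 < A.rate i m := by
  rw [rate_eq]
  have := A.rate_factor_pos hM hm
  positivity

lemma rate_mono (hC₁ : 0 < A.C₁) (hM : 1 ≤ A.M) {i j : ℕ} (hd : A.d i ≤ A.d j) {m : ℕ}
    (hm : 1 ≤ m) : A.rate i m ≤ A.rate j m := by
  rw [rate_eq, rate_eq]
  have h1 := A.rate_factor_pos hM hm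
  have h2 : (A.d i : ℝ) ≤ A.d j := by exact_mod_cast hd
  gcongr

/-- Over `r` epochs each of the two logarithms grows at most by a factor `r + 1`, while the length
grows at least by `2 ^ r / 2`, and `2 * (r + 1) ^ 2 / 2 ^ r ≤ 9 / 2`. This substitutes for exact
monotonicity of the rate. -/
lemma rate_add_le (hC₁ : 0 < A.C₁) (hM : 1 ≤ A.M) (i : ℕ) {m : ℕ} (hm : 1 ≤ m) (r : ℕ) :
    A.rate i (m + r) ≤ 5 * A.rate i m := by
  have hlen := A.two_le_len hm
  have hlenr := A.two_le_len (show 1 ≤ m + r by omega)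
  obtain ⟨h1, h2⟩ := A.len_add_le hm r
  have hl := A.log_len_pos hm
  have hb := A.log_one_div_conf_pos hM hm
  have hδ := A.δ_pos
  have hM' : (1 : ℝ) ≤ A.M := by exact_mod_cast hM
  have hm' : (1 : ℝ) ≤ m := by exact_mod_cast hm
  have hlog : Real.log (A.len (m + r)) ≤ (r + 1 : ℕ) * Real.log (A.len m) := by
    rw [← Real.log_pow]
    refine Real.log_le_log (by positivity) ?_
    have : A.len (m + r) ≤ A.len m ^ (r + 1) := by
      rw [pow_succ]
      exact h1.trans (Nat.mul_le_mul_right _ (Nat.pow_le_pow_left hlen r))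
    exact_mod_cast this
  have hconf : Real.log (1 / A.conf (m + r)) ≤ (r + 1 : ℕ) * Real.log (1 / A.conf m) := by
    have h4 := A.four_le_one_div_conf hM hm
    rw [← Real.log_pow]
    refine Real.log_le_log (by have := A.conf_pos hM (show 1 ≤ m + r by omega); positivity) ?_
    have h5 : ((m : ℝ) + r) ^ 2 ≤ (m : ℝ) ^ 2 * 4 ^ r := by
      have h6 : (r + 1 : ℝ) ≤ 2 ^ r := by exact_mod_cast Nat.lt_two_pow_self
      have h7 : (m : ℝ) + r ≤ m * 2 ^ r := by nlinarith [Nat.cast_nonneg (α := ℝ) r]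
      calc ((m : ℝ) + r) ^ 2 ≤ ((m : ℝ) * 2 ^ r) ^ 2 := by gcongr
        _ = (m : ℝ) ^ 2 * 4 ^ r := by rw [mul_pow, ← pow_mul, mul_comm r 2, pow_mul]; norm_num
    have h8 : 1 / A.conf (m + r) ≤ 1 / A.conf m * 4 ^ r := by
      rw [one_div_conf, one_div_conf]
      push_cast
      rw [div_mul_eq_mul_div, mul_assoc (4 * (A.M : ℝ))]
      gcongr
    rw [pow_succ, mul_comm]
    refine h8.trans (mul_le_mul_of_nonneg_left (pow_le_pow_left₀ (by norm_num) h4 r) (by linarith))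
  have hinv : 1 / (A.len (m + r) : ℝ) ≤ 2 / (2 ^ r * A.len m) := by
    rw [div_le_div_iff₀ (by positivity) (by positivity)]
    have : (2 : ℝ) ^ r * A.len m ≤ 2 * A.len (m + r) := by exact_mod_cast h2
    linarith
  have hr : ((r + 1 : ℕ) : ℝ) ^ 2 * 2 ≤ 5 * 2 ^ r := by
    have : (4 : ℝ) * ((r + 1 : ℕ) : ℝ) ^ 2 ≤ 9 * 2 ^ r := by exact_mod_cast four_mul_succ_sq_le r
    have h2r : (0 : ℝ) < 2 ^ r := by positivity
    linarith
  rw [rate_eq, rate_eq]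
  have hmain : Real.log (A.len (m + r)) * Real.log (1 / A.conf (m + r)) / A.len (m + r) ≤
      5 * (Real.log (A.len m) * Real.log (1 / A.conf m) / A.len m) := by
    have hbr := A.log_one_div_conf_pos hM (show 1 ≤ m + r by omega)
    calc Real.log (A.len (m + r)) * Real.log (1 / A.conf (m + r)) / A.len (m + r)
        = Real.log (A.len (m + r)) * Real.log (1 / A.conf (m + r)) * (1 / A.len (m + r)) := by
          ring
      _ ≤ ((r + 1 : ℕ) * Real.log (A.len m)) * ((r + 1 : ℕ) * Real.log (1 / A.conf m)) *
          (2 / (2 ^ r * A.len m)) := by gcongr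
      _ = (((r + 1 : ℕ) : ℝ) ^ 2 * 2) *
          (Real.log (A.len m) * Real.log (1 / A.conf m) / A.len m) / 2 ^ r := by
          field_simp
      _ ≤ (5 * 2 ^ r) * (Real.log (A.len m) * Real.log (1 / A.conf m) / A.len m) / 2 ^ r := by
          have := A.rate_factor_pos hM hm
          gcongr
      _ = _ := by field_simp
  calc _ ≤ A.C₁ * A.d i * (5 * (Real.log (A.len m) * Real.log (1 / A.conf m) / A.len m)) := by
        gcongr
    _ = _ := by ring

end Inputs

end ContextualBandit

namespace ContextualBandit

namespace Inputs

variable {X S : Type*} [MeasurableSpace X] [MeasurableSpace S] {K : ℕ} {A : Inputs X S K}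

/-! ### Comparison of epochs through their end times -/

lemma two_pow_le_τ {m : ℕ} (hm : 1 ≤ m) : 2 ^ m ≤ A.τ m := by
  obtain ⟨n, rfl⟩ := Nat.exists_eq_add_of_le' hm
  have := A.two_le_τ₁
  simp only [τ, pow_succ]
  exact Nat.mul_le_mul_left _ this

lemma τ_add {m : ℕ} (hm : 1 ≤ m) (r : ℕ) : A.τ (m + r) = 2 ^ r * A.τ m := by
  induction r with
  | zero => simp
  | succ r ih => rw [← add_assoc, A.τ_succ (by omega), ih]; ring

lemma le_of_τ_le {m n : ℕ} (hm : 1 ≤ m) (h : A.τ m ≤ A.τ n) : m ≤ n := by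
  by_contra hlt
  push Not at hlt
  rcases Nat.eq_zero_or_pos n with rfl | hn
  · have := A.τ_pos hm
    have h0 : A.τ 0 = 0 := rfl
    omega
  · have h1 := A.τ_mono (show n + 1 ≤ m from hlt)
    rw [A.τ_succ hn] at h1
    have := A.τ_pos hn
    omega

lemma τ_le_four_mul_len {m : ℕ} (hm : 1 ≤ m) : A.τ (m + 1) ≤ 4 * A.len m := by
  rw [A.τ_succ hm]
  match m, hm with
  | 1, _ => rw [len_one]; simp only [τ]; omega
  | m + 2, _ => rw [len_add_two]; simp only [τ, pow_succ]; nlinarith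

/-! ### Selected index and estimation error on the good event -/

section Index

variable {h : ℕ → Round X S K}

lemma one_le_index (hM : 1 ≤ A.M) (m : ℕ) : 1 ≤ A.index h m ∧ A.index h m ≤ A.M := by
  unfold index
  split_ifs with hI
  · exact Finset.mem_Icc.1 (A.indexSet_subset h m (Finset.min'_mem _ hI))
  · exact ⟨hM, le_rfl⟩

lemma index_le_of_mem {i m : ℕ} (hi : i ∈ A.indexSet h m) : A.index h m ≤ i := by
  unfold index
  rw [dif_pos ⟨i, hi⟩]
  exact Finset.min'_le _ _ hi

variable {E : Env X K} {F : ℕ → Set (X → Fin K → ℝ)} {C₀ : ℝ} {β : ℕ → ENNReal} {β' : ℕ → ℝ}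

namespace GoodHistory

lemma mem_indexSet (hg : A.GoodHistory E F C₀ β β' h) {i : ℕ} (hi : i ∈ Finset.Icc 1 A.M)
    {m : ℕ} (hm : (A.τ (m - 1) : ENNReal) ≤ ENNReal.ofReal (β' i) * A.safeTime E F C₀ i) :
    i ∈ A.indexSet h m := by
  induction m with
  | zero => exact hi
  | succ m ih =>
    match m with
    | 0 => exact hi
    | m + 1 =>
      refine Finset.mem_filter.2 ⟨ih (le_trans ?_ hm), hg.accept i hi (m + 1) (by omega) hm⟩
      exact_mod_cast A.τ_mono (show m + 1 - 1 ≤ m + 1 + 1 - 1 by omega)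

/-- By monotonicity of `β`, every class below `j` fails the test in epoch `m`. If no class survives,
the default index `M` is still at least `j`. -/
lemma le_index (hg : A.GoodHistory E F C₀ β β' h) (hM : 1 ≤ A.M)
    (hβ : ∀ i ∈ Finset.Icc 1 A.M, ∀ j ∈ Finset.Icc 1 A.M, i ≤ j → β i ≤ β j)
    {j : ℕ} (hj : j ∈ Finset.Icc 1 A.M) {m : ℕ} (hm : 1 ≤ m) (hτ : β (j - 1) < A.τ m) :
    j ≤ A.index h (m + 1) := by
  rw [Finset.mem_Icc] at hj
  by_contra hlt
  push Not at hlt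
  obtain ⟨n, rfl⟩ := Nat.exists_eq_add_of_le' hm
  by_cases hI : (A.indexSet h (n + 1 + 1)).Nonempty
  · have hidx : A.index h (n + 1 + 1) ∈ A.indexSet h (n + 1 + 1) := by
      have h1 := Finset.min'_mem _ hI
      unfold index
      rwa [dif_pos hI]
    obtain ⟨h1, h2⟩ := A.one_le_index (h := h) hM (n + 1 + 1)
    have h3 := hβ _ (Finset.mem_Icc.2 ⟨h1, h2⟩) (j - 1) (Finset.mem_Icc.2 (by omega)) (by omega)
    have h4 := hg.reject _ (Finset.mem_Icc.2 ⟨h1, h2⟩) (n + 1) (by omega) (h3.trans_lt hτ)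
    have h5 := (Finset.mem_filter.1 hidx).2
    rw [h4] at h5
    exact absurd h5 (by decide)
  · rw [index, dif_neg hI] at hlt
    omega

lemma exists_safe {i : ℕ} {m : ℕ} (hm : 1 ≤ m) (hβ' : β' i ∈ Set.Ioc (0 : ℝ) 1)
    (hτ : (A.τ m : ENNReal) ≤ ENNReal.ofReal (β' i) * A.safeTime E F C₀ i) :
    ∃ r, C₀ * sInf ((fun i' => worstMisspec E (F i')) '' Set.Icc 1 i) ≤ A.rate i (m + r) := by
  have h1 : (m : ℕ∞) ≤ A.safeEpoch E F C₀ i := by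
    by_cases htop : A.safeEpoch E F C₀ i = ⊤
    · rw [htop]; exact le_top
    · have h2 : (A.τ m : ENNReal) ≤ A.τ (A.safeEpoch E F C₀ i).toNat := by
        rw [safeTime, if_neg htop] at hτ
        refine hτ.trans (mul_le_of_le_one_left' ?_)
        rw [← ENNReal.ofReal_one]
        exact ENNReal.ofReal_le_ofReal hβ'.2
      have h3 := A.le_of_τ_le hm (by exact_mod_cast h2)
      rw [← ENat.natCast_toNat htop]
      exact_mod_cast h3
  -- Strictness produces an element `b ≥ m` of the defining set, whether the supremum is finite or
  -- infinite.
  have h4 : ((m - 1 : ℕ) : ℕ∞) < A.safeEpoch E F C₀ i :=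
    lt_of_lt_of_le (by exact_mod_cast (show m - 1 < m by omega)) h1
  obtain ⟨_, ⟨b, hb, rfl⟩, hlt⟩ := lt_sSup_iff.1 h4
  have hlt' : m - 1 < b := Nat.cast_lt.1 hlt
  refine ⟨b - m, ?_⟩
  rw [show m + (b - m) = b by omega]
  exact hb.2

/-- Applying the oracle bound to a class `i' ≤ i` of least misspecification gives two terms: its
rate is at most `rate i m`, and its misspecification is at most the rate of a later safe epoch, so
at most `5 * rate i m`. -/
lemma sqError_le (hg : A.GoodHistory E F C₀ β β' h) (hC₁ : 0 < A.C₁) (hM : 1 ≤ A.M)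
    (hd : ∀ i ∈ Finset.Icc 1 A.M, ∀ j ∈ Finset.Icc 1 A.M, i ≤ j → A.d i ≤ A.d j)
    {i : ℕ} (hi : i ∈ Finset.Icc 1 A.M) {m : ℕ} (hm : 1 ≤ m) (hβ' : β' i ∈ Set.Ioc (0 : ℝ) 1)
    (hτ : (A.τ m : ENNReal) ≤ ENNReal.ofReal (β' i) * A.safeTime E F C₀ i) :
    sqError E (A.kernel h m) (A.fhat h (m + 1)) ≤ 6 * A.rate i m := by
  rw [Finset.mem_Icc] at hi
  obtain ⟨r, hr⟩ := exists_safe hm hβ' hτ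
  obtain ⟨i', hi', hmin⟩ := ((Set.nonempty_Icc.2 hi.1).image
    fun i' => worstMisspec E (F i')).csInf_mem ((Set.finite_Icc 1 i).image _)
  have hi'M : i' ∈ Finset.Icc 1 A.M := Finset.mem_Icc.2 ⟨hi'.1, hi'.2.trans hi.2⟩
  have h1 := hg.est m hm i' hi'M
  have h2 : A.rate i' m ≤ A.rate i m :=
    A.rate_mono hC₁ hM (hd _ hi'M _ (Finset.mem_Icc.2 hi) hi'.2) hm
  have h3 := A.rate_add_le hC₁ hM i hm r
  simp only at hmin
  rw [← hmin] at hr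
  change _ ≤ _ + A.rate i' m at h1
  linarith

end GoodHistory

end Index

/-! ### Regret of the epochs -/

/-- Conditional regret of a round of epoch `m`. -/
lemma integral_regret_eq_expGap (A : Inputs X S K) (E : Env X K) (p : X → Fin K → ℝ) :
    ∫ x, ∑ a, p x a * E.regret x a ∂E.D.fst = A.expGap E E.fstar p := by
  simp only [expGap, A.regret_eq_gap]

section Regret

variable {h : ℕ → Round X S K} {E : Env X K} {F : ℕ → Set (X → Fin K → ℝ)} {C₀ : ℝ}

lemma γ_succ_eq {m : ℕ} (hm : 1 ≤ m) :
    A.γ h (m + 1) = √(K / (8 * A.rate (A.index h (m + 1)) m)) := by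
  obtain ⟨n, rfl⟩ := Nat.exists_eq_add_of_le' hm
  rfl

/-- Comparability of the gaps in the epochs whose index lies between `j` and `i`. -/
lemma gapsComparable_epoch (hC₁ : 0 < A.C₁) (hM : 1 ≤ A.M)
    (hd1 : ∀ i ∈ Finset.Icc 1 A.M, 1 ≤ A.d i)
    (hd : ∀ i ∈ Finset.Icc 1 A.M, ∀ j ∈ Finset.Icc 1 A.M, i ≤ j → A.d i ≤ A.d j)
    {i j : ℕ} (hi : i ∈ Finset.Icc 1 A.M) (hj : j ∈ Finset.Icc 1 A.M) {k n : ℕ} (hk : 1 ≤ k)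
    (hidx : ∀ m, k ≤ m → m < n → j ≤ A.index h (m + 1) ∧ A.index h (m + 1) ≤ i)
    {W : ℝ} (hW : ∀ m, 1 ≤ m → m < n → A.rate i m ≤ W / A.len m)
    (herr : ∀ m, 1 ≤ m → m < n → sqError E (A.kernel h m) (A.fhat h (m + 1)) ≤ 6 * A.rate i m)
    {m : ℕ} (hkm : k ≤ m) (hmn : m < n) :
    A.GapsComparable E (A.fhat h (m + 1))
        ((1 / 4) ^ (m - k) + 400 * √((A.d i : ℝ) / A.d j) * √(K * (W / A.len m))) ∧
      A.expGap E E.fstar (A.kernel h (m + 1)) ≤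
        (1 / 4) ^ (m - k) + 406 * √((A.d i : ℝ) / A.d j) * √(K * (W / A.len m)) := by
  set ρ := √((A.d i : ℝ) / A.d j) with hρ
  have hK : (0 : ℝ) < K := by exact_mod_cast A.K_pos
  have hdi : (1 : ℝ) ≤ A.d i := by exact_mod_cast hd1 i hi
  have hdj : (1 : ℝ) ≤ A.d j := by exact_mod_cast hd1 j hj
  have hρ2 : ρ ^ 2 = (A.d i : ℝ) / A.d j := Real.sq_sqrt (by positivity)
  have hji : ∀ m, k ≤ m → m < n → 1 ≤ ρ := fun m h1 h2 => by
    rw [hρ, Real.one_le_sqrt, one_le_div (by linarith)]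
    exact_mod_cast hd j hj i hi ((hidx m h1 h2).1.trans (hidx m h1 h2).2)
  have tuning : ∀ m, k ≤ m → m < n → 0 < A.γ h (m + 1) ∧
      K / A.γ h (m + 1) ≤ 3 * √(K * (W / A.len m)) ∧
      30 * A.rate i m * A.γ h (m + 1) ≤ 11 * ρ * √(K * (W / A.len m)) := fun m h1 h2 => by
    have hm : 1 ≤ m := hk.trans h1
    obtain ⟨h3, h4⟩ := hidx m h1 h2
    have hq : A.index h (m + 1) ∈ Finset.Icc 1 A.M := Finset.mem_Icc.2 (A.one_le_index hM _)
    have hx := A.rate_pos hC₁ hM (hd1 _ hq) hm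
    rw [γ_succ_eq hm]
    refine ⟨Real.sqrt_pos.2 (by positivity), sqrt_div_tuning hK hx
      (A.rate_mono hC₁ hM (hd _ hq _ hi h4) hm) (hW m hm h2) (Real.sqrt_nonneg _) ?_⟩
    rw [hρ2, div_mul_eq_mul_div, le_div_iff₀ (by linarith), rate_eq, rate_eq]
    have h5 := A.rate_factor_pos hM hm
    have h6 : (A.d j : ℝ) ≤ A.d (A.index h (m + 1)) := by exact_mod_cast hd _ hj _ hq h3
    have h7 : 0 ≤ A.C₁ * A.d i *
        (Real.log (A.len m) * Real.log (1 / A.conf m) / A.len m) := by positivity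
    nlinarith [mul_le_mul_of_nonneg_left h6 h7]
  have hcomp : A.GapsComparable E (A.fhat h (m + 1))
      ((1 / 4) ^ (m - k) + 400 * ρ * √(K * (W / A.len m))) := by
    induction m, hkm using Nat.le_induction with
    | base =>
      -- The recursion restarts here with the trivial error 1; nothing is needed about the indices
      -- of earlier epochs.
      refine A.gapsComparable_of_one_le E (A.isModel_fhat h _) ?_
      rw [Nat.sub_self, pow_zero]
      have : 0 ≤ 400 * ρ * √(K * (W / A.len k)) := by positivity
      linarith
    | succ m hkm ih =>
      have hm : 1 ≤ m := hk.trans hkm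
      have hmn' : m < n := by omega
      obtain ⟨hγ, t1, t2⟩ := tuning m hkm hmn'
      refine ((ih hmn').step (A.isModel_fhat h _) (A.isModel_fhat h _) hγ
        (herr (m + 1) (by omega) hmn)).mono ?_
      have hρ1 := hji m hkm hmn'
      set v := √(K * (W / A.len m)) with hv
      set v' := √(K * (W / A.len (m + 1))) with hv'
      have hv0 : 0 ≤ v := Real.sqrt_nonneg _
      have hWpos : 0 ≤ W := by
        have h1 := (A.rate_pos hC₁ hM (hd1 _ hi) hm).le.trans (hW m hm hmn')
        have h2 : (0 : ℝ) < A.len m := by have := A.two_le_len hm; positivity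
        have h3 := mul_nonneg h1 h2.le
        rwa [div_mul_cancel₀ _ h2.ne'] at h3
      have hlen := (A.len_add_le hm 1).1
      have hlen' : (A.len (m + 1) : ℝ) ≤ 2 * A.len m := by
        rw [pow_one] at hlen; exact_mod_cast hlen
      have hvv : v ≤ 10 / 7 * v' := by
        refine abs_le_of_sq_le_sq' ?_ (by positivity) |>.2
        have h1 : (0 : ℝ) < A.len m := by have := A.two_le_len hm; positivity
        have h2 : (0 : ℝ) < A.len (m + 1) := by
          have := A.two_le_len (show 1 ≤ m + 1 by omega); positivity
        rw [mul_pow, hv, hv', Real.sq_sqrt (by positivity), Real.sq_sqrt (by positivity)]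
        have h3 : W / A.len m ≤ 2 * (W / A.len (m + 1)) := by
          rw [mul_div_assoc', div_le_div_iff₀ h1 h2]
          nlinarith
        have h4 : 0 ≤ K * (W / A.len (m + 1)) := by positivity
        nlinarith [mul_le_mul_of_nonneg_left h3 hK.le]
      have hrate : A.rate i (m + 1) ≤ 5 * A.rate i m := A.rate_add_le hC₁ hM i hm 1
      have hpow : (1 / 4 : ℝ) ^ (m + 1 - k) = (1 / 4) ^ (m - k) / 4 := by
        rw [show m + 1 - k = (m - k) + 1 by omega, pow_succ]; ring
      rw [hpow]
      have e1 : (K : ℝ) / (16 * A.γ h (m + 1)) = K / A.γ h (m + 1) / 16 := by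
        rw [mul_comm, div_mul_eq_div_div]
      -- `γ` in epoch `m + 1` was tuned to the rate of epoch `m`, whereas the new error is governed
      -- by the rate of epoch `m + 1`; this costs the factor 5.
      have e2 : 6 * A.rate i (m + 1) * A.γ h (m + 1) ≤ 30 * A.rate i m * A.γ h (m + 1) := by
        have := mul_le_mul_of_nonneg_right hrate hγ.le
        linarith
      have e3 : v ≤ ρ * v := le_mul_of_one_le_left hv0 hρ1
      have e4 : ρ * v ≤ ρ * (10 / 7 * v') := mul_le_mul_of_nonneg_left hvv (by linarith)
      have e5 : 0 ≤ ρ * v := by positivity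
      -- In units of `ρ * v` the new error is at most `100 + 3/4 + 176`, and `277 * 10 / 7 ≤ 400`.
      rw [e1]
      linarith
  refine ⟨hcomp, ?_⟩
  obtain ⟨hγ, t1, -⟩ := tuning m hkm hmn
  have h1 := (hcomp _ (A.isActionKernel_kernel h (m + 1))).1
  have h2 : A.expGap E (A.fhat h (m + 1)) (A.kernel h (m + 1)) ≤ K / A.γ h (m + 1) :=
    A.expGap_igw_le E (A.isModel_fhat h _) hγ
  have h3 : √(K * (W / A.len m)) ≤ ρ * √(K * (W / A.len m)) :=
    le_mul_of_one_le_left (Real.sqrt_nonneg _) (hji m hkm hmn)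
  linarith

/-- Bound on the conditional regret when the indices of the epochs `k + 1, k + 2, …` lie
between `j` and `i`. -/
lemma cumCondRegret_le (hC₁ : 0 < A.C₁) (hM : 1 ≤ A.M)
    (hd1 : ∀ i ∈ Finset.Icc 1 A.M, 1 ≤ A.d i)
    (hd : ∀ i ∈ Finset.Icc 1 A.M, ∀ j ∈ Finset.Icc 1 A.M, i ≤ j → A.d i ≤ A.d j)
    {i j : ℕ} (hi : i ∈ Finset.Icc 1 A.M) (hj : j ∈ Finset.Icc 1 A.M) {k t : ℕ} (hk : 1 ≤ k)
    (ht : 3 ≤ t)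
    (hidx : ∀ m, k ≤ m → m < A.epoch t → j ≤ A.index h (m + 1) ∧ A.index h (m + 1) ≤ i)
    (herr : ∀ m, 1 ≤ m → m < A.epoch t →
      sqError E (A.kernel h m) (A.fhat h (m + 1)) ≤ 6 * A.rate i m) :
    A.cumCondRegret E h t ≤ 2 * A.τ (k + 1) + 1624 * √(50 * A.C₁) * (√((A.d i : ℝ) / A.d j) *
      √(K * A.d i * t * Real.log t * Real.log (A.M * Real.log t / A.δ))) := by
  have hl := log_nat_ge ht
  have hy := log_ge_of_ge (A.one_le_M_log_div hM ht).1
  set l := Real.log t with hl_def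
  set g := Real.log (A.M * l / A.δ) with hg_def
  set ρ := √((A.d i : ℝ) / A.d j) with hρ
  set W := 50 * A.C₁ * A.d i * l * g with hW_def
  have hW0 : 0 ≤ W := by positivity
  have hepoch : ∀ m, m < A.epoch t → A.τ m < t := fun m hm =>
    (A.τ_mono (show m ≤ A.epoch t - 1 by omega)).trans_lt (A.τ_pred_epoch_lt (by omega))
  have hW : ∀ m, 1 ≤ m → m < A.epoch t → A.rate i m ≤ W / A.len m := fun m hm hmt => by
    have h1 := hepoch m hmt
    have h2 := A.τ_pred_add_len m
    have hlen := A.two_le_len hm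
    have h3 : Real.log (A.len m) ≤ l :=
      Real.log_le_log (by positivity) (by exact_mod_cast (show A.len m ≤ t by omega))
    have h4 : Real.log (1 / A.conf m) ≤ 50 * g :=
      A.log_one_div_conf_le hM ht hm ((A.two_pow_le_τ hm).trans h1.le)
    have h5 := (A.log_one_div_conf_pos hM hm).le
    rw [rate_eq, ← mul_div_assoc]
    refine div_le_div_of_nonneg_right ?_ (Nat.cast_nonneg _)
    calc A.C₁ * A.d i * (Real.log (A.len m) * Real.log (1 / A.conf m))
        ≤ A.C₁ * A.d i * (l * (50 * g)) := by gcongr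
      _ = W := by rw [hW_def]; ring
  have hround : ∀ s ∈ Finset.Icc 1 t,
      ∫ x, ∑ a, A.kernel h (A.epoch s) x a * E.regret x a ∂E.D.fst ≤
        min 1 ((A.τ (k + 1) : ℝ) ^ 2 / (s : ℝ) ^ 2) + 812 * ρ * √(K * W) * (1 / √(s : ℝ)) := by
    intro s hs
    rw [Finset.mem_Icc] at hs
    rw [A.integral_regret_eq_expGap]
    have hs0 : (0 : ℝ) < s := by exact_mod_cast hs.1
    have hle1 := A.expGap_le_one E E.isModel_fstar (A.isActionKernel_kernel h (A.epoch s))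
    have hpos : 0 ≤ 812 * ρ * √(K * W) * (1 / √(s : ℝ)) := by positivity
    have hsτ := A.le_τ_epoch s
    by_cases hcase : A.epoch s ≤ k + 1
    · have h1 : (s : ℝ) ≤ A.τ (k + 1) := by exact_mod_cast hsτ.trans (A.τ_mono hcase)
      rw [min_eq_left]
      · linarith
      · rw [one_le_div (by positivity)]
        gcongr
    · push Not at hcase
      obtain ⟨m, hm⟩ : ∃ m, A.epoch s = m + 1 := ⟨A.epoch s - 1, by omega⟩
      have hst : A.epoch s ≤ A.epoch t := A.epoch_le (hs.2.trans (A.le_τ_epoch t))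
      have hkm : k ≤ m := by omega
      have hm1 : 1 ≤ m := hk.trans hkm
      have key := (A.gapsComparable_epoch (E := E) hC₁ hM hd1 hd hi hj hk hidx hW herr hkm
        (by omega)).2
      rw [hm] at hle1 hsτ ⊢
      have hτ : A.τ (m + 1) = 2 ^ (m - k) * A.τ (k + 1) := by
        rw [← A.τ_add (by omega)]; congr 1; omega
      -- Since `s ≤ τ (m + 1) = 2 ^ (m - k) * τ (k + 1)`, the geometric decay over epochs becomes
      -- quadratic decay over rounds.
      have h1 : (1 / 4 : ℝ) ^ (m - k) ≤ (A.τ (k + 1) : ℝ) ^ 2 / (s : ℝ) ^ 2 := by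
        have h2 : (s : ℝ) ≤ 2 ^ (m - k) * A.τ (k + 1) := by exact_mod_cast hτ ▸ hsτ
        rw [one_div, inv_pow, le_div_iff₀ (by positivity), inv_mul_le_iff₀ (by positivity)]
        calc (s : ℝ) ^ 2 ≤ (2 ^ (m - k) * A.τ (k + 1)) ^ 2 := by gcongr
          _ = 4 ^ (m - k) * (A.τ (k + 1) : ℝ) ^ 2 := by
            rw [mul_pow, ← pow_mul, mul_comm _ 2, pow_mul]; norm_num
      -- Round `s` lies in epoch `m + 1`, so `s ≤ τ (m + 1) ≤ 4 * len m`; this turns 406 into 812.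
      have h3 : √(K * (W / A.len m)) ≤ 2 * (√(K * W) * (1 / √(s : ℝ))) := by
        have hlen : (s : ℝ) ≤ 4 * A.len m := by
          exact_mod_cast hsτ.trans (A.τ_le_four_mul_len hm1)
        have hlen0 : (0 : ℝ) < A.len m := by have := A.two_le_len hm1; positivity
        rw [← Real.sqrt_one, ← Real.sqrt_div zero_le_one, ← Real.sqrt_mul (by positivity),
          show (2 : ℝ) = √4 by rw [show (4 : ℝ) = 2 ^ 2 by norm_num]; simp,
          ← Real.sqrt_mul (by norm_num)]
        refine Real.sqrt_le_sqrt ?_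
        rw [show 4 * (K * W * (1 / s)) = K * (4 * W / s) by ring]
        refine mul_le_mul_of_nonneg_left ?_ (Nat.cast_nonneg _)
        rw [div_le_div_iff₀ hlen0 hs0]
        nlinarith
      have h4 : (1 / 4 : ℝ) ^ (m - k) ≤ 1 := pow_le_one₀ (by norm_num) (by norm_num)
      have h5 := mul_le_mul_of_nonneg_left h3 (show 0 ≤ 406 * ρ by positivity)
      have h6 := le_min h4 h1
      linarith
  have hsum : A.cumCondRegret E h t ≤ 2 * A.τ (k + 1) + 812 * ρ * √(K * W) * (2 * √(t : ℝ)) := by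
    refine (Finset.sum_le_sum hround).trans ?_
    rw [Finset.sum_add_distrib, ← Finset.mul_sum]
    exact add_le_add (sum_min_one_sq_div_le (Nat.cast_nonneg _) t)
      (mul_le_mul_of_nonneg_left (sum_one_div_sqrt_le t) (by positivity))
  refine hsum.trans (le_of_eq ?_)
  have h1 : √(K * W) * √(t : ℝ) = √(50 * A.C₁) * √(K * A.d i * t * l * g) := by
    rw [← Real.sqrt_mul (by positivity), ← Real.sqrt_mul (by positivity), hW_def]
    congr 1
    ring
  linear_combination (2 * 812 * ρ) * h1

lemma cumRegret_le_nat (A : Inputs X S K) (E : Env X K) (h : ℕ → Round X S K) (t : ℕ) :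
    cumRegret E h t ≤ t ∧ A.cumCondRegret E h t ≤ t := by
  constructor
  · refine (Finset.sum_le_sum fun s _ => (A.regret_mem E _ _).2).trans ?_
    simp
  · refine (Finset.sum_le_sum fun s _ => (A.integral_regret_eq_expGap E _).le.trans
      (A.expGap_le_one E E.isModel_fstar (A.isActionKernel_kernel h _))).trans ?_
    simp

lemma ofReal_le_mul_regretBound {c x : ℝ} (hc : 1 ≤ c) (β : ℕ → ENNReal) (i j t : ℕ)
    (hx : ENNReal.ofReal x ≤ A.regretBound β i j t) :
    ENNReal.ofReal x ≤ ENNReal.ofReal c * A.regretBound β i j t :=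
  hx.trans (le_mul_of_one_le_left' (by rwa [← ENNReal.ofReal_one, ENNReal.ofReal_le_ofReal_iff
    (by linarith)]))

/-- The regret bound in terms of the first epoch after `β_{j-1}`. -/
lemma ofReal_le_mul_regretBound_of_lt_τ {c₁ b x : ℝ} (hc₁ : 0 ≤ c₁) {β : ℕ → ENNReal}
    {i j t m : ℕ} (hm : 1 ≤ m) (hb : 0 ≤ b) (hβ : β (j - 1) = ENNReal.ofReal b)
    (hτ : 1 < m → (A.τ (m - 1) : ℝ) ≤ b) (hL : 1 / 2 ≤ A.logFactor i j)
    (hx : x ≤ 2 * A.τ (m + 1) + c₁ * (√((A.d i : ℝ) / A.d j) *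
      √(K * A.d i * t * Real.log t * Real.log (A.M * Real.log t / A.δ)))) :
    ENNReal.ofReal x ≤ ENNReal.ofReal (16 + 2 * c₁) * A.regretBound β i j t := by
  set Q := √((A.d i : ℝ) / A.d j) *
      √(K * A.d i * t * Real.log t * Real.log (A.M * Real.log t / A.δ)) with hQ
  have hQ0 : 0 ≤ Q := by positivity
  have h1 : A.regretBound β i j t = ENNReal.ofReal (A.τ₁ + b * A.logFactor i j + Q) := by
    rw [regretBound, hβ, ← ENNReal.ofReal_mul hb, ← ENNReal.ofReal_natCast,
      ← ENNReal.ofReal_add (by positivity) (by positivity),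
      ← ENNReal.ofReal_add (by positivity) (by positivity)]
  rw [h1, ← ENNReal.ofReal_mul (by positivity)]
  refine ENNReal.ofReal_le_ofReal (hx.trans ?_)
  -- If `m = 1` then `τ (m + 1) = 2 * τ₁`; otherwise `τ (m + 1) = 4 * τ (m - 1)`, which is at most
  -- `4 * b`.
  have h2 : (A.τ (m + 1) : ℝ) ≤ 2 * A.τ₁ + 4 * b := by
    rw [A.τ_succ hm]
    push_cast
    rcases hm.eq_or_lt with rfl | hm'
    · simp only [τ, pow_zero, one_mul]; linarith
    · have h3 := hτ hm'
      obtain ⟨n, rfl⟩ : ∃ n, m = n + 1 := ⟨m - 1, by omega⟩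
      rw [Nat.add_sub_cancel] at h3
      rw [A.τ_succ (by omega)]
      push_cast
      linarith [Nat.cast_nonneg (α := ℝ) A.τ₁]
  have h3 : b ≤ 2 * (b * A.logFactor i j) := by nlinarith
  have h4 : 0 ≤ c₁ * (A.τ₁ + b * A.logFactor i j) := by
    have : 0 ≤ b * A.logFactor i j := by linarith
    positivity
  have h5 := mul_nonneg hc₁ hQ0
  have h6 : (0 : ℝ) ≤ A.τ₁ := Nat.cast_nonneg _
  nlinarith

end Regret

/-- The regret bound on the good event. -/
lemma GoodHistory.regret_le {E : Env X K} {F : ℕ → Set (X → Fin K → ℝ)} {C₀ : ℝ}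
    {β : ℕ → ENNReal} {β' : ℕ → ℝ} {h : ℕ → Round X S K} (hg : A.GoodHistory E F C₀ β β' h)
    (hC₁ : 0 < A.C₁) (hM : 1 ≤ A.M) (hd1 : ∀ i ∈ Finset.Icc 1 A.M, 1 ≤ A.d i)
    (hd : ∀ i ∈ Finset.Icc 1 A.M, ∀ j ∈ Finset.Icc 1 A.M, i ≤ j → A.d i ≤ A.d j)
    (hβ : ∀ i ∈ Finset.Icc 1 A.M, ∀ j ∈ Finset.Icc 1 A.M, i ≤ j → β i ≤ β j)
    (hβ' : ∀ i ∈ Finset.Icc 1 A.M, β' i ∈ Set.Ioc (0 : ℝ) 1)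
    (hβ'lt : ∀ i ∈ Finset.Icc 1 A.M,
      ENNReal.ofReal (β' i) * A.safeTime E F C₀ i < β i ∨ β i = ⊤)
    {i j : ℕ} (hi : i ∈ Finset.Icc 1 A.M) (hj : j ∈ Finset.Icc 1 A.M) {t : ℕ} (ht : 1 ≤ t)
    (hsafe : (t : ENNReal) ≤ ENNReal.ofReal (β' i) * A.safeTime E F C₀ i) :
    ∀ x, x = cumRegret E h t ∨ x = A.cumCondRegret E h t →
      ENNReal.ofReal x ≤
        ENNReal.ofReal (16 + 2 * (2 * (1624 * √(50 * A.C₁)) + 16)) * A.regretBound β i j t := by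
  intro x hx
  set c₁ := 1624 * √(50 * A.C₁) with hc₁
  have hc₁0 : 0 ≤ c₁ := by positivity
  have hxt : x ≤ t := by
    rcases hx with rfl | rfl
    · exact (A.cumRegret_le_nat E h t).1
    · exact (A.cumRegret_le_nat E h t).2
  have hxt' : ENNReal.ofReal x ≤ t := by
    rw [← ENNReal.ofReal_natCast]; exact ENNReal.ofReal_le_ofReal hxt
  by_cases htτ : t ≤ A.τ₁
  · refine ofReal_le_mul_regretBound (by linarith) β i j t (hxt'.trans ?_)
    rw [regretBound, add_assoc]
    exact le_add_right (by exact_mod_cast htτ)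
  push Not at htτ
  have ht3 : 3 ≤ t := by have := A.two_le_τ₁; omega
  have hiM := Finset.mem_Icc.1 hi
  have hjM := Finset.mem_Icc.1 hj
  have h1M : 1 ∈ Finset.Icc 1 A.M := Finset.mem_Icc.2 ⟨le_rfl, hM⟩
  have hdi : (1 : ℝ) ≤ A.d i := by exact_mod_cast hd1 i hi
  have hdj : (1 : ℝ) ≤ A.d j := by exact_mod_cast hd1 j hj
  have hd₁ : (1 : ℝ) ≤ A.d 1 := by exact_mod_cast hd1 1 h1M
  have hd1i : (A.d 1 : ℝ) ≤ A.d i := by exact_mod_cast hd 1 h1M i hi hiM.1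
  have hlog0 : 0 ≤ Real.log (A.d i / A.d 1) :=
    Real.log_nonneg ((one_le_div (by linarith)).2 hd1i)
  rcases lt_or_ge i j with hij | hij
  -- For `j > i` the safe time of `i` is at most `β i ≤ β (j - 1)`, so the trivial bound by `t`
  -- suffices; the additional 1 in `logFactor` serves this case.
  · refine ofReal_le_mul_regretBound (by linarith) β i j t (hxt'.trans ?_)
    have h1 : (t : ENNReal) ≤ β (j - 1) := by
      have h2 := hβ i hi (j - 1) (Finset.mem_Icc.2 (by omega)) (by omega)
      rcases hβ'lt i hi with h3 | h3
      · exact (hsafe.trans h3.le).trans h2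
      · rw [h3] at h2; exact le_top.trans h2
    have h2 : 1 ≤ ENNReal.ofReal (A.logFactor i j) := by
      rw [← ENNReal.ofReal_one]
      refine ENNReal.ofReal_le_ofReal ?_
      rw [logFactor, if_neg (by omega)]
      linarith
    rw [regretBound]
    exact (h1.trans (le_mul_of_one_le_right' h2)).trans (le_add_right (le_add_left le_rfl))
  set Q₀ := √(K * A.d i * t * Real.log t * Real.log (A.M * Real.log t / A.δ)) with hQ₀
  have hepoch : ∀ m, m < A.epoch t → A.τ m < t := fun m hm =>
    (A.τ_mono (show m ≤ A.epoch t - 1 by omega)).trans_lt (A.τ_pred_epoch_lt (by omega))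
  have hsafe' : ∀ m, m < A.epoch t →
      (A.τ m : ENNReal) ≤ ENNReal.ofReal (β' i) * A.safeTime E F C₀ i := fun m hm =>
    le_trans (by exact_mod_cast (hepoch m hm).le) hsafe
  have hup : ∀ m, m < A.epoch t → A.index h (m + 1) ≤ i := fun m hm =>
    A.index_le_of_mem (hg.mem_indexSet hi (hsafe' m hm))
  have herr : ∀ m, 1 ≤ m → m < A.epoch t →
      sqError E (A.kernel h m) (A.fhat h (m + 1)) ≤ 6 * A.rate i m := fun m h1 h2 =>
    hg.sqError_le hC₁ hM hd hi h1 (hβ' i hi) (hsafe' m h2)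
  have hdev : x ≤ A.cumCondRegret E h t + 8 * Q₀ := by
    have hQ : √(t * Real.log (12 * t ^ 2 / A.δ)) ≤ 8 * Q₀ := by
      have hl := log_nat_ge ht3
      have hy := log_ge_of_ge (A.one_le_M_log_div hM ht3).1
      have h1 := A.log_deviation_le hM ht3
      have hK : (1 : ℝ) ≤ K := by exact_mod_cast A.K_pos
      rw [hQ₀, show (8 : ℝ) = √64 by rw [show (64 : ℝ) = 8 ^ 2 by norm_num]; simp,
        ← Real.sqrt_mul (by norm_num)]
      refine Real.sqrt_le_sqrt ?_
      set w := Real.log t * Real.log (A.M * Real.log t / A.δ) with hw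
      have hw0 : 0 ≤ w := by positivity
      calc t * Real.log (12 * t ^ 2 / A.δ) ≤ t * (64 * w) := by gcongr; linarith
        _ = 64 * (1 * 1 * t * w) := by ring
        _ ≤ 64 * (K * A.d i * t * w) := by gcongr
        _ = _ := by rw [hw]; ring
    rcases hx with rfl | rfl
    · exact (hg.concentration t ht).trans (by linarith)
    · have : 0 ≤ Q₀ := Real.sqrt_nonneg _
      linarith
  have hQ₀0 : 0 ≤ Q₀ := Real.sqrt_nonneg _
  have hdji : (A.d j : ℝ) ≤ A.d i := by exact_mod_cast hd j hj i hi hij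
  have hρ : 1 ≤ √((A.d i : ℝ) / A.d j) := by
    rw [Real.one_le_sqrt, one_le_div (by linarith)]
    exact hdji
  have hρQ : Q₀ ≤ √((A.d i : ℝ) / A.d j) * Q₀ := le_mul_of_one_le_left hQ₀0 hρ
  -- Here `ln (d i / d 1)` may vanish, and the term with `β (j - 1)` is of no help. Class 1 takes
  -- the role of `j` from the first epoch, at the price `√(d i / d 1) ≤ 2`.
  by_cases hratio : (A.d i : ℝ) < 2 * A.d 1
  · have h1 := A.cumCondRegret_le (E := E) (h := h) hC₁ hM hd1 hd hi h1M le_rfl ht3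
      (fun m _ h2 => ⟨(A.one_le_index hM _).1, hup m h2⟩) herr
    have h2 : √((A.d i : ℝ) / A.d 1) ≤ 2 := by
      rw [Real.sqrt_le_left (by norm_num), div_le_iff₀ (by linarith)]
      linarith
    have h3 : √((A.d i : ℝ) / A.d 1) * Q₀ ≤ 2 * (√((A.d i : ℝ) / A.d j) * Q₀) :=
      mul_le_mul h2 hρQ hQ₀0 (by norm_num)
    have h4 := mul_le_mul_of_nonneg_left h3 hc₁0
    have h5 : (A.τ (1 + 1) : ℝ) = 2 * A.τ₁ := by simp [τ]
    rw [h5] at h1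
    have h6 : x ≤ (16 + 2 * (2 * c₁ + 16)) * (A.τ₁ + √((A.d i : ℝ) / A.d j) * Q₀) := by
      have e1 : 0 ≤ √((A.d i : ℝ) / A.d j) * Q₀ := hQ₀0.trans hρQ
      have e2 : (0 : ℝ) ≤ A.τ₁ := Nat.cast_nonneg _
      have e3 := mul_nonneg hc₁0 e1
      have e4 := mul_nonneg hc₁0 e2
      nlinarith
    refine (ENNReal.ofReal_le_ofReal h6).trans ?_
    rw [ENNReal.ofReal_mul (by positivity),
      ENNReal.ofReal_add (p := (A.τ₁ : ℝ)) (by positivity) (by positivity),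
      ENNReal.ofReal_natCast, regretBound, add_assoc]
    gcongr
    exact le_add_left le_rfl
  · push Not at hratio
    have hL : 1 / 2 ≤ A.logFactor i j := by
      rw [logFactor, if_pos hij]
      have h1 : (2 : ℝ) ≤ A.d i / A.d 1 := by rwa [le_div_iff₀ (by linarith)]
      linarith [Real.log_le_log (by norm_num) h1, Real.log_two_gt_d9]
    by_cases htop : β (j - 1) = ⊤
    · have h1 : A.regretBound β i j t = ⊤ := by
        rw [regretBound, htop, ENNReal.top_mul]
        · simp
        · rw [Ne, ENNReal.ofReal_eq_zero]; linarith
      rw [h1, ENNReal.mul_top]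
      · exact le_top
      · rw [Ne, ENNReal.ofReal_eq_zero]; linarith
    · have hb : β (j - 1) = ENNReal.ofReal (β (j - 1)).toReal := (ENNReal.ofReal_toReal htop).symm
      set b := (β (j - 1)).toReal with hb_def
      -- The first epoch that ends after `β (j - 1)`: from the next one on, all classes below `j`
      -- are excluded.
      have hex : ∃ m, b < A.τ m := by
        obtain ⟨n, hn⟩ := exists_nat_gt b
        obtain ⟨m, hm⟩ := A.exists_le_τ n
        exact ⟨m, hn.trans_le (by exact_mod_cast hm)⟩
      classical
      set m := Nat.find hex with hm_def
      have hm := Nat.find_spec hex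
      have hb0 : 0 ≤ b := ENNReal.toReal_nonneg
      have hm1 : 1 ≤ m := by
        by_contra h0
        have h1 : m = 0 := by omega
        rw [← hm_def, h1] at hm
        simp only [τ, Nat.cast_zero] at hm
        linarith
      have hlow : ∀ m', m ≤ m' → j ≤ A.index h (m' + 1) := fun m' hm' => by
        refine hg.le_index hM hβ hj (hm1.trans hm') ?_
        rw [hb, ← ENNReal.ofReal_natCast, ENNReal.ofReal_lt_ofReal_iff_of_nonneg hb0]
        exact hm.trans_le (by exact_mod_cast A.τ_mono hm')
      have h1 := A.cumCondRegret_le (E := E) (h := h) hC₁ hM hd1 hd hi hj hm1 ht3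
        (fun m' h1 h2 => ⟨hlow m' h1, hup m' h2⟩) herr
      refine ofReal_le_mul_regretBound_of_lt_τ (by positivity) hm1 hb0 hb (fun h2 => ?_) hL
        (x := x) (c₁ := 2 * c₁ + 16) ?_
      · exact not_lt.1 (Nat.find_min hex (show m - 1 < m by omega))
      · have e1 : 0 ≤ √((A.d i : ℝ) / A.d j) * Q₀ := hQ₀0.trans hρQ
        have e3 := mul_nonneg hc₁0 e1
        linarith

end Inputs

end ContextualBandit

theorem theorem2 (C₁ : ℝ) (hC₁ : 0 < C₁) :
    ∃ c : ℝ, 0 < c ∧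
      ∀ (X S : Type*) [MeasurableSpace X] [MeasurableSpace S] (K : ℕ)
        (E : Env X K) (A : Inputs X S K) (F : ℕ → Set (X → Fin K → ℝ)) (C₀ : ℝ)
        (Ω : Type*) [mΩ : MeasurableSpace Ω] (P : Measure Ω) [IsProbabilityMeasure P]
        (ℱ : Filtration ℕ mΩ) (z : ℕ → Ω → Round X S K)
        (β : ℕ → ENNReal) (β' : ℕ → ℝ),
        A.C₁ = C₁ →
        1 ≤ C₀ →
        -- the classes consist of models; `d i` is the (positive, finite) VC-subgraph dimension
        (∀ i ∈ Finset.Icc 1 A.M, ∀ f ∈ F i, IsModel f) →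
        (∀ i ∈ Finset.Icc 1 A.M, vcSubgraphDim (F i) = (A.d i : ℕ∞) ∧ 1 ≤ A.d i) →
        (∀ i ∈ Finset.Icc 1 A.M, ∀ j ∈ Finset.Icc 1 A.M, i ≤ j → A.d i ≤ A.d j) →
        A.EstOracleAssumption E F C₀ →
        A.IsRun E P ℱ z →
        A.TestAssumption E F C₀ P z β β' →
        ∃ G : Set Ω, MeasurableSet G ∧ ENNReal.ofReal (1 - A.δ) ≤ P G ∧
          ∀ ω ∈ G, ∀ i ∈ Finset.Icc 1 A.M, ∀ j ∈ Finset.Icc 1 A.M, ∀ t : ℕ, 1 ≤ t →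
            (t : ENNReal) ≤ ENNReal.ofReal (β' i) * A.safeTime E F C₀ i →
            ENNReal.ofReal (Inputs.cumRegret E (fun s => z s ω) t)
                ≤ ENNReal.ofReal c * A.regretBound β i j t ∧
            ENNReal.ofReal (A.cumCondRegret E (fun s => z s ω) t)
                ≤ ENNReal.ofReal c * A.regretBound β i j t := by
  refine ⟨16 + 2 * (2 * (1624 * √(50 * C₁)) + 16), by positivity, ?_⟩
  intro X S _ _ K E A F C₀ Ω mΩ P _ ℱ z β β' hAC hC₀ hF hd hdmono hest hrun htest
  by_cases hM : 1 ≤ A.M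
  · obtain ⟨G, hGm, hG, hgood⟩ := hrun.exists_good hC₀ hF hest htest hM
    refine ⟨G, hGm, hG, fun ω hω i hi j hj t ht hsafe => ?_⟩
    have key := (hgood ω hω).regret_le (by rwa [hAC]) hM (fun i hi => (hd i hi).2) hdmono
      htest.β_mono htest.β'_mem htest.β'_lt hi hj ht hsafe
    rw [hAC] at key
    exact ⟨key _ (Or.inl rfl), key _ (Or.inr rfl)⟩
  -- Without classes the claim about `i` and `j` is vacuous.
  · refine ⟨Set.univ, .univ, ?_, fun ω _ i hi => ?_⟩
    · rw [measure_univ]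
      exact ENNReal.ofReal_le_one.2 (by linarith [A.δ_pos])
    · rw [Finset.mem_Icc] at hi
      omega
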